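/- Let $N$ be a simply connected Lie group whose (finite-dimensional, real) Lie algebra $\mathfrak n$ with center $\mathfrak z$ satisfies $[\mathfrak n,\mathfrak n]\subseteq\mathfrak z$, let $\Gamma\subset N$ be a lattice (a discrete subgroup with $\Gamma\backslash N$ compact), and put $\log\Gamma=\{x\in\mathfrak n:\exp x\in\Gamma\}$. Let $\langle\,,\rangle$ be a nondegenerate symmetric bilinear form (of any signature) on $\mathfrak n$; give $N$ the induced left-invariant metric tensor, and $\Gamma\backslash N$ the metric tensor for which the projection $p_N:N\to\Gamma\backslash N$ is a local isometry. The form may be degenerate on $\mathfrak z$. Let $\mathcal U=\mathfrak z\cap\mathfrak z^\perp$, let $\mathcal V\subset\mathfrak n$ be a totally null subspace that $\langle\,,\rangle$ pairs perfectly with $\mathcal U$ (that is, $\mathfrak n=\mathcal V\oplus\mathcal U^\perp$), let $\mathcal Z=\mathfrak z\cap\mathcal U^\perp\cap\mathcal V^\perp$, let $\mathcal E=\mathcal Z^\perp\cap\mathcal U^\perp\cap\mathcal V^\perp$ and $\mathfrak v=\mathcal V\oplus\mathcal E$. Then $\mathfrak n=\mathfrak z\oplus\mathfrak v$; let $\pi:\mathfrak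 n\to\mathfrak v$ be the projection along $\mathfrak z$. Then $\log\Gamma\cap\mathfrak z$ is a vector lattice in $\mathfrak z$ and $\pi(\log\Gamma)$ is a vector lattice in $\mathfrak v$. Let $T_{\mathfrak z}=\mathfrak z/(\log\Gamma\cap\mathfrak z)$, a torus with the flat (possibly degenerate) metric tensor induced by $\langle\,,\rangle|_{\mathfrak z}$, and let $T_B$ be the torus $\mathfrak v/\pi(\log\Gamma)$ with the metric tensor induced by $\langle\,,\rangle|_{\mathfrak v}$. There is a map $p_B:\Gamma\backslash N\to T_B$ with $p_B(p_N(\exp x))=\pi(x)+\pi(\log\Gamma)$ for all $x\in\mathfrak n$, and it is a generalized pseudoriemannian submersion: a smooth surjective submersion such that, at every point of $\Gamma\backslash N$, the kernel of $p_{B*}$ consists of the values of the left-invariant fields in $\mathfrak z$, and $p_{B*}$ maps the space of values of the left-invariant fields in $\mathfrak v$ isometrically onto the tangent space of $T_B$. Every fiber $T_F=p_B^{-1}(b)$, $b\in T_B$, is an embedded submanifold of $\Gamma\backslash N$ which, with the (possibly degenerate) metric tensor induced from $\Gamma\backslash N$, is isometric to $T_{\mathfrak z}$: there is a smooth embedding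 $f:T_{\mathfrak z}\to\Gamma\backslash N$ with image $p_B^{-1}(b)$ that pulls the metric tensor of $\Gamma\backslash N$ back to that of $T_{\mathfrak z}$. -/

import Mathlib

open scoped Manifold ContDiff

noncomputable section

namespace Nilmanifold

/-! ### Metric tensors and quotient manifolds -/

section Metrics

variable {E : Type*} [NormedAddCommGroup E] [NormedSpace ℝ E]
  {F : Type*} [NormedAddCommGroup F] [NormedSpace ℝ F]
  {X : Type*} [TopologicalSpace X] [ChartedSpace E X]
  {Y : Type*} [TopologicalSpace Y] [ChartedSpace F Y]

/-- A (possibly indefinite, possibly degenerate) metric tensor, given by its values on pairs of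
tangent vectors at each point. -/
abbrev MetricTensor (E X : Type*) [NormedAddCommGroup E] [NormedSpace ℝ E]
    [TopologicalSpace X] [ChartedSpace E X] : Type _ :=
  ∀ x : X, TangentSpace 𝓘(ℝ, E) x → TangentSpace 𝓘(ℝ, E) x → ℝ

/-- The metric tensor on the base `Q` of a surjective local diffeomorphism `p : X → Q` which makes
`p` a local isometry. It is computed at an arbitrary preimage of the given point; it is used only
for metrics invariant under the deck transformations, where the choice does not matter. -/
def descendedMetric {Q : Type*} [TopologicalSpace Q] [ChartedSpace E Q] (p : X → Q)
    (hp : Function.Surjective p) (g : MetricTensor E X) : MetricTensor E Q :=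
  fun q u v ↦ g (Function.surjInv hp q)
    ((mfderiv 𝓘(ℝ, E) 𝓘(ℝ, E) p (Function.surjInv hp q)).inverse u)
    ((mfderiv 𝓘(ℝ, E) 𝓘(ℝ, E) p (Function.surjInv hp q)).inverse v)

/-- `f` is a smooth embedding (smooth, a homeomorphism onto its image, with injective
differentials) that pulls the metric tensor `gY` back to `gX`. Thus `f` is an isometry from
`(X, gX)` onto the embedded submanifold `f(X)` with the metric tensor induced by `gY`. -/
structure IsIsometricEmbedding (gX : MetricTensor E X) (gY : MetricTensor F Y) (f : X → Y) :
    Prop where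
  contMDiff : ContMDiff 𝓘(ℝ, E) 𝓘(ℝ, F) ∞ f
  isEmbedding : Topology.IsEmbedding f
  injective_mfderiv : ∀ x, Function.Injective (mfderiv 𝓘(ℝ, E) 𝓘(ℝ, F) f x)
  isometric : ∀ x (u v : TangentSpace 𝓘(ℝ, E) x),
    gY (f x) (mfderiv 𝓘(ℝ, E) 𝓘(ℝ, F) f x u) (mfderiv 𝓘(ℝ, E) 𝓘(ℝ, F) f x v) = gX x u v

end Metrics

/-! ### Quotients of a vector space by a discrete subgroup -/

section Torus

variable {W : Type*} [NormedAddCommGroup W]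

/-- The quotient `W / Λ` (a torus when `Λ` is a vector lattice). -/
def Torus (Λ : AddSubgroup W) : Type _ := W ⧸ Λ

instance (Λ : AddSubgroup W) : TopologicalSpace (Torus Λ) :=
  inferInstanceAs (TopologicalSpace (W ⧸ Λ))

/-- The projection `W → W / Λ`. -/
def Torus.mk (Λ : AddSubgroup W) (w : W) : Torus Λ := (QuotientAddGroup.mk w : W ⧸ Λ)

theorem Torus.mk_surjective (Λ : AddSubgroup W) : Function.Surjective (Torus.mk Λ) :=
  QuotientAddGroup.mk_surjective

theorem Torus.mk_isLocalHomeomorph (Λ : AddSubgroup W) [DiscreteTopology Λ] :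
    IsLocalHomeomorph (Torus.mk Λ) :=
  (AddSubgroup.isAddQuotientCoveringMap_of_comm Λ ⟨inferInstance⟩).isCoveringMap.isLocalHomeomorph

/-- The smooth structure of `W / Λ`, with local inverses of the projection as charts. -/
instance (Λ : AddSubgroup W) [DiscreteTopology Λ] : ChartedSpace W (Torus Λ) :=
  (Torus.mk_isLocalHomeomorph Λ).chartedSpace (Torus.mk_surjective Λ)

/-- The flat metric tensor of `W / Λ` induced by the constant metric tensor `b` on `W`. -/
def Torus.metric [NormedSpace ℝ W] (Λ : AddSubgroup W) [DiscreteTopology Λ]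
    (b : LinearMap.BilinForm ℝ W) : MetricTensor W (Torus Λ) :=
  descendedMetric (Torus.mk Λ) (Torus.mk_surjective Λ) (fun _ (u v : W) ↦ b u v)

end Torus

/-! ### Lie groups, lattices and left-invariant metrics

The Lie algebra of `N` is the tangent space `GroupLieAlgebra 𝓘(ℝ, E) N` at `1`, with the bracket of
left-invariant vector fields. Its underlying vector space is `E` by definition, and its elements
and subspaces are written as elements and subspaces of `E`. -/

section Group

variable (E : Type*) [NormedAddCommGroup E] [NormedSpace ℝ E]
  (N : Type*) [TopologicalSpace N] [ChartedSpace E N] [Group N]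

/-- A smooth real Lie group has the regularity under which the Lie bracket is defined. -/
instance [LieGroup 𝓘(ℝ, E) ∞ N] : LieGroup 𝓘(ℝ, E) (minSmoothness ℝ 3) N := by
  rw [minSmoothness_of_isRCLikeNormedField]
  infer_instance

open Classical in
/-- The exponential map of `N`: `exp x = γ 1`, for the integral curve `γ` with `γ 0 = 1` of the
left-invariant vector field given by `x`. -/
def exp (x : E) : N :=
  if h : ∃ γ : ℝ → N, γ 0 = 1 ∧
      IsMIntegralCurve (I := 𝓘(ℝ, E)) γ
        (mulInvariantVectorField (x : GroupLieAlgebra 𝓘(ℝ, E) N)) then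
    h.choose 1
  else 1

/-- `N` is 2-step nilpotent: `[𝔫, 𝔫]` lies in the center of `𝔫`. -/
def IsTwoStep [CompleteSpace E] [LieGroup 𝓘(ℝ, E) ∞ N] : Prop :=
  ∀ x y : GroupLieAlgebra 𝓘(ℝ, E) N,
    ⁅x, y⁆ ∈ LieAlgebra.center ℝ (GroupLieAlgebra 𝓘(ℝ, E) N)

/-- The center `𝔷` of the Lie algebra `𝔫`. -/
def center [CompleteSpace E] [LieGroup 𝓘(ℝ, E) ∞ N] : Submodule ℝ E :=
  (LieAlgebra.center ℝ (GroupLieAlgebra 𝓘(ℝ, E) N)).toSubmodule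

variable {N}

/-- `log Γ`, as the set of all `x` with `exp x ∈ Γ`. -/
def logSet (Γ : Subgroup N) : Set E := {x | exp E N x ∈ Γ}

/-- The left-invariant metric tensor on `N` induced by a bilinear form on its Lie algebra. -/
def leftInvariantMetric (B : LinearMap.BilinForm ℝ E) : MetricTensor E N :=
  fun n u v ↦ B ((mfderiv 𝓘(ℝ, E) 𝓘(ℝ, E) (fun m : N ↦ n * m) 1).inverse u)
    ((mfderiv 𝓘(ℝ, E) 𝓘(ℝ, E) (fun m : N ↦ n * m) 1).inverse v)

/-- The space `Γ\N` of orbits of left multiplication by `Γ` on `N`. -/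
def LeftQuotient {N : Type*} [Group N] (Γ : Subgroup N) : Type _ := MulAction.orbitRel.Quotient Γ N

instance {N : Type*} [TopologicalSpace N] [Group N] (Γ : Subgroup N) :
    TopologicalSpace (LeftQuotient Γ) :=
  inferInstanceAs (TopologicalSpace (MulAction.orbitRel.Quotient Γ N))

/-- The projection `p_N : N → Γ\N`. -/
def pN {N : Type*} [Group N] (Γ : Subgroup N) (n : N) : LeftQuotient Γ := (Quotient.mk _ n : MulAction.orbitRel.Quotient Γ N)

theorem pN_surjective {N : Type*} [Group N] (Γ : Subgroup N) : Function.Surjective (pN Γ) := Quotient.mk_surjective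

theorem pN_isLocalHomeomorph [LieGroup 𝓘(ℝ, E) ∞ N] (Γ : Subgroup N) [DiscreteTopology Γ] :
    IsLocalHomeomorph (pN Γ) := by
  have : IsTopologicalGroup N := topologicalGroup_of_lieGroup 𝓘(ℝ, E) ∞
  have h : Topology.IsQuotientMap (pN Γ) := isQuotientMap_quotient_mk'
  exact (h.isQuotientCoveringMap_of_subgroup Γ ⟨inferInstance⟩
    (Quotient.eq''.trans QuotientGroup.rightRel_apply)).isCoveringMap.isLocalHomeomorph

/-- The smooth structure of `Γ\N`, with charts of `N` composed with local inverses of `p_N`. -/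
instance [LieGroup 𝓘(ℝ, E) ∞ N] (Γ : Subgroup N) [DiscreteTopology Γ] :
    ChartedSpace E (LeftQuotient Γ) :=
  (pN_isLocalHomeomorph E Γ).chartedSpace (pN_surjective Γ)

/-- The metric tensor of `Γ\N` for which `p_N` is a local isometry. -/
def quotMetric [LieGroup 𝓘(ℝ, E) ∞ N] (Γ : Subgroup N) [DiscreteTopology Γ]
    (B : LinearMap.BilinForm ℝ E) : MetricTensor E (LeftQuotient Γ) :=
  descendedMetric (pN Γ) (pN_surjective Γ) (leftInvariantMetric E B)

end Group

/-! ### The splitting `𝔫 = 𝔷 ⊕ 𝔳` -/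

section Splitting

variable {E : Type*} [AddCommGroup E] [Module ℝ E]

/-- The null part `𝒰 = 𝔷 ∩ 𝔷^⊥` of the subspace `𝔷`. -/
def nullPart (B : LinearMap.BilinForm ℝ E) (z : Submodule ℝ E) : Submodule ℝ E :=
  z ⊓ B.orthogonal z

/-- `V` is a null subspace complementary to `𝒰` in the sense of Witt: it is totally null, and the
inner product is a dual pairing between `𝒰` and `V`. -/
structure IsWittComplement (B : LinearMap.BilinForm ℝ E) (z V : Submodule ℝ E) : Prop where
  isNull : ∀ v ∈ V, ∀ w ∈ V, B v w = 0
  isCompl : IsCompl V (B.orthogonal (nullPart B z))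

/-- The part `𝒵 = 𝔷 ∩ 𝒰^⊥ ∩ V^⊥` of the subspace `𝔷`. -/
def centralPart (B : LinearMap.BilinForm ℝ E) (z V : Submodule ℝ E) : Submodule ℝ E :=
  z ⊓ (B.orthogonal (nullPart B z) ⊓ B.orthogonal V)

/-- The orthogonal complement `ℰ` of `𝒵` in `𝒰^⊥ ∩ V^⊥`. -/
def orthPart (B : LinearMap.BilinForm ℝ E) (z V : Submodule ℝ E) : Submodule ℝ E :=
  B.orthogonal (centralPart B z V) ⊓ (B.orthogonal (nullPart B z) ⊓ B.orthogonal V)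

/-- The complement `𝔳 = V ⊕ ℰ` of `𝔷` determined by `V`. -/
def vSpace (B : LinearMap.BilinForm ℝ E) (z V : Submodule ℝ E) : Submodule ℝ E :=
  V ⊔ orthPart B z V

theorem isCompl_vSpace [FiniteDimensional ℝ E] {B : LinearMap.BilinForm ℝ E} (hs : B.IsSymm)
    (hB : B.Nondegenerate) {z V : Submodule ℝ E} (hV : IsWittComplement B z V) :
    IsCompl z (vSpace B z V) := by
  set U := nullPart B z with hU
  have hr : B.IsRefl := hs.isRefl
  have key : U ⊔ B.orthogonal V = ⊤ := by
    rw [← B.orthogonal_orthogonal hB hr (U ⊔ B.orthogonal V)]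
    have : B.orthogonal (U ⊔ B.orthogonal V) = ⊥ := by
      rw [eq_bot_iff, ← hV.isCompl.inf_eq_bot]
      refine le_inf ?_ (LinearMap.BilinForm.orthogonal_le le_sup_left)
      refine (LinearMap.BilinForm.orthogonal_le le_sup_right).trans ?_
      rw [B.orthogonal_orthogonal hB hr]
    rw [this, LinearMap.BilinForm.orthogonal_bot]
  have hUz : U ≤ z := inf_le_left
  have hUzo : U ≤ B.orthogonal z := inf_le_right
  -- `𝔷 = 𝒰 + 𝒵`
  have hz : ∀ x ∈ z, ∃ u ∈ U, ∃ c ∈ centralPart B z V, x = u + c := by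
    intro x hx
    have hx' : x ∈ U ⊔ B.orthogonal V := by rw [key]; trivial
    obtain ⟨u, hu, c, hc, rfl⟩ := Submodule.mem_sup.1 hx'
    refine ⟨u, hu, c, ?_, rfl⟩
    have hcz : c ∈ z := by simpa using z.sub_mem hx (hUz hu)
    refine ⟨hcz, ?_, hc⟩
    intro w hw
    exact hr _ _ (hUzo hw c hcz)
  -- `ℰ = (𝔷 + V)^⊥`
  have hE : orthPart B z V = B.orthogonal (z ⊔ V) := by
    apply le_antisymm
    · rintro e ⟨h1, h2, h3⟩ x hx
      obtain ⟨a, ha, v, hv, rfl⟩ := Submodule.mem_sup.1 hx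
      obtain ⟨u, hu, c, hc, rfl⟩ := hz a ha
      have e1 : B u e = 0 := h2 u hu
      have e2 : B c e = 0 := h1 c hc
      have e3 : B v e = 0 := h3 v hv
      simp [e1, e2, e3]
    · refine le_inf ?_ (le_inf ?_ ?_)
      · exact LinearMap.BilinForm.orthogonal_le (inf_le_left.trans le_sup_left)
      · exact LinearMap.BilinForm.orthogonal_le (hUz.trans le_sup_left)
      · exact LinearMap.BilinForm.orthogonal_le le_sup_right
  -- an element of `𝒰` orthogonal to `V` vanishes
  have hUV : ∀ u ∈ U, u ∈ B.orthogonal V → u = 0 := by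
    intro u hu huV
    have : u ∈ B.orthogonal (V ⊔ B.orthogonal U) := by
      intro x hx
      obtain ⟨v, hv, w, hw, rfl⟩ := Submodule.mem_sup.1 hx
      have e1 : B v u = 0 := huV v hv
      have e2 : B w u = 0 := hr _ _ (hw u hu)
      simp [e1, e2]
    rw [hV.isCompl.sup_eq_top, LinearMap.BilinForm.orthogonal_top_eq_bot hB] at this
    simpa using this
  -- `𝔷 + V` is nondegenerate
  have hdisj : Disjoint (z ⊔ V) (B.orthogonal (z ⊔ V)) := by
    rw [Submodule.disjoint_def]
    intro x hx hx'
    obtain ⟨a, ha, v, hv, rfl⟩ := Submodule.mem_sup.1 hx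
    have hv0 : v = 0 := by
      have : v ∈ V ⊓ B.orthogonal U := by
        refine ⟨hv, fun u hu ↦ ?_⟩
        have e1 : B u (a + v) = 0 := hx' u (le_sup_left (a := z) (hUz hu))
        have e2 : B u a = 0 := hr _ _ (hUzo hu a ha)
        rw [map_add, e2, zero_add] at e1
        exact e1
      rw [hV.isCompl.inf_eq_bot] at this
      simpa using this
    subst hv0
    rw [add_zero] at hx' ⊢
    refine hUV a ⟨ha, ?_⟩ ?_
    · exact LinearMap.BilinForm.orthogonal_le le_sup_left hx'
    · exact LinearMap.BilinForm.orthogonal_le le_sup_right hx'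
  have hcompl := (B.isCompl_orthogonal_iff_disjoint hr).2 hdisj
  have hzV : Disjoint z V := by
    rw [Submodule.disjoint_def]
    intro x hx hxV
    have : x ∈ V ⊓ B.orthogonal U := ⟨hxV, fun u hu ↦ hr _ _ (hUzo hu x hx)⟩
    rw [hV.isCompl.inf_eq_bot] at this
    simpa using this
  rw [vSpace, hE]
  refine ⟨?_, ?_⟩
  · exact hzV.disjoint_sup_right_of_disjoint_sup_left hcompl.disjoint
  · rw [codisjoint_iff, ← sup_assoc, hcompl.sup_eq_top]

/-- The projection `π : 𝔫 → 𝔳` along `𝔷`. -/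
def vProj {z v : Submodule ℝ E} (h : IsCompl z v) : E →ₗ[ℝ] v :=
  Submodule.projectionOnto v z h.symm

end Splitting

/-! ### The generalized pseudoriemannian submersion onto the base torus -/

section Submersion

variable {E : Type*} [NormedAddCommGroup E] [NormedSpace ℝ E] [CompleteSpace E]
  {N : Type*} [TopologicalSpace N] [ChartedSpace E N] [Group N] [LieGroup 𝓘(ℝ, E) ∞ N]

/-- The vector of `T(Γ\N)` at `p_N n` represented by the left-invariant field `x`. -/
def frame (Γ : Subgroup N) [DiscreteTopology Γ] (x : E) (n : N) :
    TangentSpace 𝓘(ℝ, E) (pN Γ n) :=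
  mfderiv 𝓘(ℝ, E) 𝓘(ℝ, E) (pN Γ) n
    (mulInvariantVectorField (x : GroupLieAlgebra 𝓘(ℝ, E) N) n)

/-- `p : Γ\N → v / L` is a smooth surjective submersion, its differential kills exactly the central
directions `𝔷(Γ\N)`, and it maps the horizontal space `v(Γ\N)` at each point isometrically to the
tangent space of `v / L`. In contrast with a pseudoriemannian submersion, the vertical and the
horizontal spaces may be degenerate and need not be orthogonal. The metric tensor of `v / L` is
the one that makes the last condition hold: the constant one given by `B` on `v`. -/
structure IsGeneralizedSubmersion (B : LinearMap.BilinForm ℝ E) (Γ : Subgroup N)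
    [DiscreteTopology Γ] (v : Submodule ℝ E) (L : AddSubgroup v) [DiscreteTopology L]
    (p : LeftQuotient Γ → Torus L) : Prop where
  contMDiff : ContMDiff 𝓘(ℝ, E) 𝓘(ℝ, v) ∞ p
  surjective : Function.Surjective p
  surjective_mfderiv : ∀ q, Function.Surjective (mfderiv 𝓘(ℝ, E) 𝓘(ℝ, v) p q)
  vertical : ∀ (n : N) (x : E),
    mfderiv 𝓘(ℝ, E) 𝓘(ℝ, v) p (pN Γ n) (frame Γ x n) = 0 ↔ x ∈ center E N
  horizontal : ∀ (n : N), ∀ x ∈ v, ∀ y ∈ v,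
    Torus.metric L (B.restrict v) (p (pN Γ n))
        (mfderiv 𝓘(ℝ, E) 𝓘(ℝ, v) p (pN Γ n) (frame Γ x n))
        (mfderiv 𝓘(ℝ, E) 𝓘(ℝ, v) p (pN Γ n) (frame Γ y n)) =
      quotMetric E Γ B (pN Γ n) (frame Γ x n) (frame Γ y n)

end Submersion

end Nilmanifold

end

/-!
The theorem rests on three facts about a simply connected 2-step nilpotent group `N`.

*The exponential map is a diffeomorphism with an explicit group law.* The derivative of the adjoint
representation at `1` is the Lie bracket (`exists_hasFDerivAt_Ad_point`, computed from second
derivatives of the multiplication in a chart), so `Ad (exp (t x)) y = y + t [x, y]`. Hence the curve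
`exp (t x) exp (t y) exp (-t (x + y)) exp (-t² [x, y] / 2)` has velocity zero, which gives the
formula `exp x * exp y = exp (x + y + [x, y] / 2)` (`IsTwoStep.exp_mul_exp`). It shows that `exp` is
smooth with differential `h ↦ h - [a, h] / 2` at `a` in left-invariant frames
(`IsTwoStep.exists_hasD_exp`), and that `exp` is a homomorphism from `𝔫` with the group law
`x + y + [x, y] / 2`. This homomorphism is a local diffeomorphism, thus a covering, and it is
bijective as `N` is simply connected (`IsTwoStep.exp_bijective`).

*The lattice splits.* In the group `𝔫` the set `log Γ` is a discrete cocompact subgroup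
(`isBCHLattice_logSet`). Its projection to `𝔳` is a cocompact subgroup, hence spans. Brackets of
elements of the projection are commutators in `log Γ`, so they lie in the discrete set `log Γ ∩ 𝔷`.
The brackets of a small element of the projection with a finite spanning set of projections are
small, hence zero, so this element commutes with everything; being in `𝔳`, it is zero
(`discreteTopology_proj`). Finitely many lattice elements then suffice to correct the bounded
projections, so that `log Γ ∩ 𝔷` is cocompact in `𝔷` (`exists_central_norm_sub_le`).

*Quotients by deck transformations.* Both `Γ\N` and the tori are quotients by smooth transformations
with charts from local sections, so that maps out of them are smooth when their lifts are, and an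
invariant metric tensor upstairs agrees with the one downstairs (`IsSmoothQuotient`).

Since `π` kills brackets, it is a homomorphism from the group `𝔫` to `𝔳`, and `π ∘ log` descends to
the base map. By the formula for the differential of `exp`, the base map sends the left-invariant
field `x` to the constant field `π x` (`D_baseMap_frame`). The fiber over `π a` is the image
of `z ↦ exp (a + z)`, `z ∈ 𝔷`, which sends the constant field `u` to the left-invariant field `u`
(`D_fiberMap_mk`) and is injective modulo `log Γ ∩ 𝔷`; the quotient is compact, so this is an
embedding.
-/

noncomputable section

set_option linter.unusedSectionVars false

namespace Nilmanifold

open scoped Topology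

/-! ### Differentials as maps between model spaces -/

section Differential

variable {E : Type*} [NormedAddCommGroup E] [NormedSpace ℝ E]
  {F : Type*} [NormedAddCommGroup F] [NormedSpace ℝ F]
  {G : Type*} [NormedAddCommGroup G] [NormedSpace ℝ G]
  {X : Type*} [TopologicalSpace X] [ChartedSpace E X]
  {Y : Type*} [TopologicalSpace Y] [ChartedSpace F Y]
  {Z : Type*} [TopologicalSpace Z] [ChartedSpace G Z]

/-- `HasMFDerivAt` for manifolds modelled on vector spaces, with the derivative regarded as a map
between the model spaces. Every tangent space is by definition a copy of the model space. -/
def HasD (f : X → Y) (x : X) (A : E →L[ℝ] F) : Prop :=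
  HasMFDerivAt 𝓘(ℝ, E) 𝓘(ℝ, F) f x A

/-- The differential `mfderiv` as a map between the model spaces. -/
def D (E F : Type*) [NormedAddCommGroup E] [NormedSpace ℝ E] [NormedAddCommGroup F]
    [NormedSpace ℝ F] {X : Type*} [TopologicalSpace X] [ChartedSpace E X]
    {Y : Type*} [TopologicalSpace Y] [ChartedSpace F Y] (f : X → Y) (x : X) : E →L[ℝ] F :=
  mfderiv 𝓘(ℝ, E) 𝓘(ℝ, F) f x

theorem HasD.comp {g : Y → Z} {f : X → Y} {x : X} {A : F →L[ℝ] G} {B : E →L[ℝ] F}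
    (hg : HasD g (f x) A) (hf : HasD f x B) : HasD (fun y ↦ g (f y)) x (A.comp B) :=
  HasMFDerivAt.comp x hg hf

theorem HasD.comp_of_eq {g : Y → Z} {f : X → Y} {x : X} {y : Y} {A : F →L[ℝ] G}
    {B : E →L[ℝ] F} (hg : HasD g y A) (hf : HasD f x B) (hy : f x = y) :
    HasD (fun y ↦ g (f y)) x (A.comp B) := by
  subst hy; exact hg.comp hf

theorem HasD.D_eq {f : X → Y} {x : X} {A : E →L[ℝ] F} (h : HasD f x A) : D E F f x = A :=
  h.mfderiv

theorem HasD.unique {f : X → Y} {x : X} {A B : E →L[ℝ] F} (h : HasD f x A) (h' : HasD f x B) :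
    A = B :=
  h.D_eq.symm.trans h'.D_eq

theorem HasD.congr {f g : X → Y} {x : X} {A : E →L[ℝ] F} (h : HasD f x A) (hg : g =ᶠ[𝓝 x] f) :
    HasD g x A :=
  HasMFDerivAt.congr_of_eventuallyEq h hg

theorem hasD_of_mdifferentiableAt {f : X → Y} {x : X}
    (h : MDifferentiableAt 𝓘(ℝ, E) 𝓘(ℝ, F) f x) : HasD f x (D E F f x) :=
  h.hasMFDerivAt

theorem hasD_of_contMDiff {f : X → Y} (h : ContMDiff 𝓘(ℝ, E) 𝓘(ℝ, F) ∞ f) (x : X) :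
    HasD f x (D E F f x) :=
  hasD_of_mdifferentiableAt (h.mdifferentiable (by simp) x)

theorem hasD_of_contMDiffAt {f : X → Y} {x : X} (h : ContMDiffAt 𝓘(ℝ, E) 𝓘(ℝ, F) ∞ f x) :
    HasD f x (D E F f x) :=
  hasD_of_mdifferentiableAt (h.mdifferentiableAt (by simp))

variable (E) in
theorem hasD_id (x : X) : HasD (fun y : X ↦ y) x (ContinuousLinearMap.id ℝ E) :=
  hasMFDerivAt_id x

theorem hasD_const (y : Y) (x : X) : HasD (fun _ : X ↦ y) x (0 : E →L[ℝ] F) :=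
  hasMFDerivAt_const y x

theorem hasD_iff_hasFDerivAt {f : E → F} {x : E} {A : E →L[ℝ] F} :
    HasD f x A ↔ HasFDerivAt f A x :=
  hasMFDerivAt_iff_hasFDerivAt

/-- In the chart at `x` and the chart at `f x`, the derivative of `f` at `x` is the derivative of
the coordinate expression. -/
theorem hasD_iff {f : X → Y} {x : X} {A : E →L[ℝ] F} (hc : ContinuousAt f x) :
    HasD f x A ↔ HasFDerivAt (fun a ↦ extChartAt 𝓘(ℝ, F) (f x) (f ((extChartAt 𝓘(ℝ, E) x).symm a)))
      A (extChartAt 𝓘(ℝ, E) x x) := by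
  constructor
  · intro h
    have := h.2
    rw [modelWithCornersSelf_coe, Set.range_id] at this
    exact hasFDerivWithinAt_univ.1 this
  · intro h
    refine ⟨hc, ?_⟩
    rw [modelWithCornersSelf_coe, Set.range_id]
    exact hasFDerivWithinAt_univ.2 h

end Differential

/-! ### Left-invariant fields and one-parameter subgroups -/

section OneParameter

variable {E : Type*} [NormedAddCommGroup E] [NormedSpace ℝ E]
  {N : Type*} [TopologicalSpace N] [ChartedSpace E N] [Group N]

/-- The left-invariant vector field on `N` with value `x` at `1`. -/
def lif (x : E) (n : N) : E :=
  mulInvariantVectorField (I := 𝓘(ℝ, E)) (G := N) x n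

theorem lif_eq_D (x : E) (n : N) : lif x n = D E E (fun m : N ↦ n * m) 1 x := rfl

theorem lif_one (x : E) : lif x (1 : N) = x := by
  have h : (fun n : N ↦ 1 * n) = fun n ↦ n := by ext n; simp
  rw [lif_eq_D, h, (hasD_id E (1 : N)).D_eq]
  rfl

theorem lif_smul (t : ℝ) (x : E) (n : N) : lif (t • x) n = t • lif x n :=
  map_smul (D E E (fun m : N ↦ n * m) 1) _ _

theorem lif_add (x y : E) (n : N) : lif (x + y) n = lif x n + lif y n :=
  map_add (D E E (fun m : N ↦ n * m) 1) _ _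

theorem lif_zero (n : N) : lif (0 : E) n = 0 :=
  map_zero (D E E (fun m : N ↦ n * m) 1)

variable [LieGroup 𝓘(ℝ, E) ∞ N]

theorem contMDiff_lif (x : E) :
    ContMDiff 𝓘(ℝ, E) 𝓘(ℝ, E).tangent 1
      (fun n : N ↦ (⟨n, lif (E := E) x n⟩ : TangentBundle 𝓘(ℝ, E) N)) := by
  refine (contMDiff_mulInvariantVectorField (I := 𝓘(ℝ, E)) (G := N) x).of_le ?_
  rw [minSmoothness_of_isRCLikeNormedField]
  exact one_le_two

theorem hasD_mul_left (g h : N) : HasD (fun n : N ↦ g * n) h (D E E (fun n : N ↦ g * n) h) :=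
  hasD_of_contMDiff (contMDiff_mul_left (I := 𝓘(ℝ, E)) (n := ∞) (a := g)) h

theorem hasD_mul_right (g h : N) : HasD (fun n : N ↦ n * g) h (D E E (fun n : N ↦ n * g) h) :=
  hasD_of_contMDiff (contMDiff_mul_right (I := 𝓘(ℝ, E)) (n := ∞) (a := g)) h

/-- Left-invariance of `lif`. -/
theorem D_mul_left_lif (g h : N) (x : E) :
    D E E (fun n : N ↦ g * n) h (lif x h) = lif x (g * h) := by
  have h1 : (fun n : N ↦ g * h * n) = (fun n : N ↦ g * (h * n)) := by
    ext n; simp [mul_assoc]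
  have h2 := (hasD_mul_left (E := E) g h).comp_of_eq (hasD_mul_left (E := E) h 1) (mul_one h)
  rw [lif_eq_D, lif_eq_D, h1, h2.D_eq]
  rfl

/-- The velocity at `t` of the curve `γ` in `X` is `v`. -/
def HasVel {X : Type*} [TopologicalSpace X] [ChartedSpace E X] (γ : ℝ → X) (t : ℝ) (v : E) :
    Prop :=
  HasD γ t ((1 : ℝ →L[ℝ] ℝ).smulRight v)

theorem HasD.hasVel {X F Y : Type*} [TopologicalSpace X] [ChartedSpace E X]
    [NormedAddCommGroup F] [NormedSpace ℝ F] [TopologicalSpace Y] [ChartedSpace F Y]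
    {f : X → Y} {γ : ℝ → X} {t : ℝ} {A : E →L[ℝ] F} {v : E}
    (hf : HasD f (γ t) A) (hγ : HasVel γ t v) : HasVel (fun s ↦ f (γ s)) t (A v) := by
  have h1 := hf.comp hγ
  have h2 : A.comp ((1 : ℝ →L[ℝ] ℝ).smulRight v) = (1 : ℝ →L[ℝ] ℝ).smulRight (A v) := by
    ext; simp
  rwa [h2] at h1

theorem HasVel.mul_left_lif {γ : ℝ → N} {x : E} {t : ℝ}
    (h : HasVel γ t (lif x (γ t))) (g : N) :
    HasVel (fun s ↦ g * γ s) t (lif x (g * γ t)) := by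
  have := (hasD_mul_left (E := E) g (γ t)).hasVel h
  rwa [D_mul_left_lif] at this

variable [CompleteSpace E] [T2Space N]

/-- Left-invariant fields are complete: the left translates of an integral curve through `1` are
integral curves through all points, defined for the same time. -/
theorem exists_integralCurve_lif (x : E) :
    ∃ γ : ℝ → N, γ 0 = 1 ∧ IsMIntegralCurve (I := 𝓘(ℝ, E)) γ (lif x) := by
  obtain ⟨γ, h0, hγ⟩ := exists_isMIntegralCurveAt_of_contMDiffAt_boundaryless (I := 𝓘(ℝ, E)) 0
    ((contMDiff_lif x).contMDiffAt (x := (1 : N)))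
  obtain ⟨ε, hε, h⟩ := isMIntegralCurveAt_iff'.1 hγ
  refine exists_isMIntegralCurve_of_isMIntegralCurveOn (M := N) (contMDiff_lif x) hε (fun n ↦ ?_) 1
  refine ⟨fun t ↦ n * γ t, by simp [h0], ?_⟩
  rw [Real.ball_eq_Ioo, zero_sub, zero_add] at h
  intro t ht
  have h1 : HasVel γ t (lif x (γ t)) := (h t ht).hasMFDerivAt (isOpen_Ioo.mem_nhds ht)
  exact HasMFDerivAt.hasMFDerivWithinAt (h1.mul_left_lif n)

theorem eq_of_integralCurve_lif {x : E} {γ γ' : ℝ → N} {t₀ : ℝ}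
    (h : IsMIntegralCurve (I := 𝓘(ℝ, E)) γ (lif x))
    (h' : IsMIntegralCurve (I := 𝓘(ℝ, E)) γ' (lif x)) (h0 : γ t₀ = γ' t₀) : γ = γ' :=
  isMIntegralCurve_Ioo_eq_of_contMDiff_boundaryless (contMDiff_lif x) h h' h0

theorem exp_eq_of_integralCurve {x : E} {γ : ℝ → N} (h0 : γ 0 = 1)
    (h : IsMIntegralCurve (I := 𝓘(ℝ, E)) γ (lif x)) : exp E N x = γ 1 := by
  have hex : ∃ γ : ℝ → N, γ 0 = 1 ∧
      IsMIntegralCurve (I := 𝓘(ℝ, E)) γ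
        (mulInvariantVectorField (x : GroupLieAlgebra 𝓘(ℝ, E) N)) := ⟨γ, h0, h⟩
  rw [exp, dif_pos hex]
  exact congrFun (eq_of_integralCurve_lif (t₀ := 0) hex.choose_spec.2 h
    (hex.choose_spec.1.trans h0.symm)) 1

theorem exp_smul_eq_of_integralCurve {x : E} {γ : ℝ → N} (h0 : γ 0 = 1)
    (h : IsMIntegralCurve (I := 𝓘(ℝ, E)) γ (lif x)) (t : ℝ) : exp E N (t • x) = γ t := by
  have h1 := h.comp_mul t
  have h2 : t • (lif x : N → E) = lif (t • x) := funext fun n ↦ (lif_smul t x n).symm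
  have := exp_eq_of_integralCurve (x := t • x) (γ := γ ∘ (· * t)) (by simp [h0]) (h2 ▸ h1)
  simpa using this

/-- `t ↦ exp (t x)` is the integral curve through `1` of the left-invariant field `x`. -/
theorem isMIntegralCurve_exp_smul (x : E) :
    IsMIntegralCurve (I := 𝓘(ℝ, E)) (fun t : ℝ ↦ exp E N (t • x)) (lif x) := by
  obtain ⟨γ, h0, h⟩ := exists_integralCurve_lif (N := N) x
  have : (fun t : ℝ ↦ exp E N (t • x)) = γ := funext (exp_smul_eq_of_integralCurve h0 h)
  rwa [this]

variable (E N) in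
theorem exp_zero : exp E N 0 = 1 := by
  obtain ⟨γ, h0, h⟩ := exists_integralCurve_lif (N := N) (0 : E)
  simpa [h0] using exp_smul_eq_of_integralCurve h0 h 0

theorem exp_add_smul (s t : ℝ) (x : E) :
    exp E N ((s + t) • x) = exp E N (s • x) * exp E N (t • x) := by
  have h1 := (isMIntegralCurve_exp_smul (N := N) x).comp_add s
  have h2 : IsMIntegralCurve (I := 𝓘(ℝ, E)) (fun t : ℝ ↦ exp E N (s • x) * exp E N (t • x))
      (lif x) := fun t ↦ HasVel.mul_left_lif (isMIntegralCurve_exp_smul x t) _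
  have := congrFun (eq_of_integralCurve_lif (t₀ := 0) h1 h2 (by simp [exp_zero])) t
  simpa [add_comm] using this

theorem exp_neg (x : E) : exp E N (-x) = (exp E N x)⁻¹ := by
  rw [eq_inv_iff_mul_eq_one]
  have := exp_add_smul (N := N) (-1) 1 x
  simpa [exp_zero] using this.symm

end OneParameter

/-! ### Regularity of solutions of autonomous equations -/

section Bootstrap

variable {E : Type*} [NormedAddCommGroup E] [NormedSpace ℝ E]

/-- Solutions of a smooth autonomous differential equation are smooth. -/
theorem contDiffAt_of_hasDerivAt_comp {f : ℝ → E} {V : E → E} {t₀ : ℝ}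
    (hf : ∀ᶠ t in 𝓝 t₀, HasDerivAt f (V (f t)) t) (hV : ContDiffAt ℝ ∞ V (f t₀)) :
    ContDiffAt ℝ ∞ f t₀ := by
  rw [contDiffAt_infty]
  intro n
  have hV' : ∀ᶠ a in 𝓝 (f t₀), ContDiffAt ℝ n V a :=
    (hV.of_le (by exact_mod_cast le_top)).eventually (by simp)
  obtain ⟨U, hU, hUo, h0⟩ := eventually_nhds_iff.1
    (hf.and (hf.self_of_nhds.continuousAt.eventually hV'))
  suffices h : ∀ k : ℕ, k ≤ n → ContDiffOn ℝ k f U from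
    (h n le_rfl).contDiffAt (hUo.mem_nhds h0)
  intro k
  induction k with
  | zero =>
    intro _
    exact contDiffOn_zero.2 fun t ht ↦ (hU t ht).1.continuousAt.continuousWithinAt
  | succ k ih =>
    intro hk
    push_cast
    rw [contDiffOn_succ_iff_deriv_of_isOpen hUo]
    refine ⟨fun t ht ↦ (hU t ht).1.differentiableAt.differentiableWithinAt, by simp, ?_⟩
    have h1 : ContDiffOn ℝ k (fun t ↦ V (f t)) U := fun t ht ↦
      ((hU t ht).2.of_le (by exact_mod_cast (by omega : k ≤ n))).comp_contDiffWithinAt t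
        (ih (by omega) t ht)
    exact h1.congr fun t ht ↦ (hU t ht).1.deriv

end Bootstrap

/-! ### Multiplication and conjugation in coordinates near the unit -/

section Coordinates

variable (E : Type*) [NormedAddCommGroup E] [NormedSpace ℝ E]
  (N : Type*) [TopologicalSpace N] [ChartedSpace E N] [Group N]

/-- The coordinates of `N` near `1` given by the preferred chart at `1`. -/
def coord (n : N) : E := extChartAt 𝓘(ℝ, E) (1 : N) n

variable {E} in
/-- The local parametrization of `N` near `1` inverse to `coord`. -/
def point (a : E) : N := (extChartAt 𝓘(ℝ, E) (1 : N)).symm a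

/-- The coordinates of `1`. -/
def origin : E := coord E N 1

theorem point_origin : point N (origin E N) = 1 := extChartAt_to_inv (I := 𝓘(ℝ, E)) (1 : N)

theorem eventually_point_coord : ∀ᶠ n in 𝓝 (1 : N), point N (coord E N n) = n := by
  filter_upwards [extChartAt_source_mem_nhds (I := 𝓘(ℝ, E)) (1 : N)] with n hn
  exact (extChartAt 𝓘(ℝ, E) (1 : N)).left_inv hn

theorem eventually_coord_point : ∀ᶠ a in 𝓝 (origin E N), coord E N (point N a) = a := by
  filter_upwards [extChartAt_target_mem_nhds (I := 𝓘(ℝ, E)) (1 : N)] with a ha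
  exact (extChartAt 𝓘(ℝ, E) (1 : N)).right_inv ha

variable [LieGroup 𝓘(ℝ, E) ∞ N]

theorem contMDiffAt_coord : ContMDiffAt 𝓘(ℝ, E) 𝓘(ℝ, E) ∞ (coord E N) 1 :=
  contMDiffAt_extChartAt

theorem contMDiffAt_point : ContMDiffAt 𝓘(ℝ, E) 𝓘(ℝ, E) ∞ (point N) (origin E N) :=
  (contMDiffOn_extChartAt_symm (I := 𝓘(ℝ, E)) (n := ∞) (1 : N)).contMDiffAt
    (extChartAt_target_mem_nhds (I := 𝓘(ℝ, E)) (1 : N))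

theorem contMDiffAt_point_eventually :
    ∀ᶠ a in 𝓝 (origin E N), ContMDiffAt 𝓘(ℝ, E) 𝓘(ℝ, E) ∞ (point N) a := by
  filter_upwards [(isOpen_extChartAt_target (I := 𝓘(ℝ, E)) (1 : N)).mem_nhds
    (mem_extChartAt_target (I := 𝓘(ℝ, E)) (1 : N))] with a ha
  exact (contMDiffOn_extChartAt_symm (I := 𝓘(ℝ, E)) (n := ∞) (1 : N)).contMDiffAt
    ((isOpen_extChartAt_target (I := 𝓘(ℝ, E)) (1 : N)).mem_nhds ha)

theorem continuousAt_coord : ContinuousAt (coord E N) 1 := (contMDiffAt_coord E N).continuousAt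

theorem continuousAt_point : ContinuousAt (point N) (origin E N) :=
  (contMDiffAt_point E N).continuousAt

theorem hasD_coord : HasD (coord E N) 1 (ContinuousLinearMap.id ℝ E) := by
  rw [hasD_iff (continuousAt_coord E N)]
  refine (hasFDerivAt_id _).congr_of_eventuallyEq ?_
  filter_upwards [eventually_coord_point E N] with a ha
  simpa using! ha

theorem hasD_point : HasD (point N) (origin E N) (ContinuousLinearMap.id ℝ E) := by
  rw [hasD_iff (continuousAt_point E N), point_origin]
  refine (hasFDerivAt_id _).congr_of_eventuallyEq ?_
  filter_upwards [eventually_coord_point E N] with a ha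
  simpa using! ha

/-- The multiplication of `N` near `(1, 1)` in the coordinates `coord`. -/
def mulC (p : E × E) : E := coord E N (point N p.1 * point N p.2)

theorem contDiffAt_mulC : ContDiffAt ℝ ∞ (mulC E N) (origin E N, origin E N) := by
  rw [← contMDiffAt_iff_contDiffAt]
  have h1 : ContMDiffAt 𝓘(ℝ, E × E) 𝓘(ℝ, E) ∞ (fun p : E × E ↦ point N p.1)
      (origin E N, origin E N) :=
    ContMDiffAt.comp _ (contMDiffAt_point E N) contDiffAt_fst.contMDiffAt
  have h2 : ContMDiffAt 𝓘(ℝ, E × E) 𝓘(ℝ, E) ∞ (fun p : E × E ↦ point N p.2)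
      (origin E N, origin E N) :=
    ContMDiffAt.comp _ (contMDiffAt_point E N) contDiffAt_snd.contMDiffAt
  refine ContMDiffAt.comp _ ?_ (h1.mul h2)
  simpa [point_origin] using contMDiffAt_coord E N

/-- Conjugation of the second argument by the first one, in the coordinates `coord`. -/
def conjC (p : E × E) : E := coord E N (point N p.1 * point N p.2 * (point N p.1)⁻¹)

theorem contDiffAt_conjC : ContDiffAt ℝ ∞ (conjC E N) (origin E N, origin E N) := by
  rw [← contMDiffAt_iff_contDiffAt]
  have h1 : ContMDiffAt 𝓘(ℝ, E × E) 𝓘(ℝ, E) ∞ (fun p : E × E ↦ point N p.1)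
      (origin E N, origin E N) :=
    ContMDiffAt.comp _ (contMDiffAt_point E N) contDiffAt_fst.contMDiffAt
  have h2 : ContMDiffAt 𝓘(ℝ, E × E) 𝓘(ℝ, E) ∞ (fun p : E × E ↦ point N p.2)
      (origin E N, origin E N) :=
    ContMDiffAt.comp _ (contMDiffAt_point E N) contDiffAt_snd.contMDiffAt
  refine ContMDiffAt.comp _ ?_ ((h1.mul h2).mul h1.inv)
  simpa [point_origin] using contMDiffAt_coord E N

theorem mulC_origin_right : ∀ᶠ a in 𝓝 (origin E N), mulC E N (a, origin E N) = a := by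
  filter_upwards [eventually_coord_point E N] with a ha
  simpa [mulC, point_origin] using ha

theorem mulC_origin_left : ∀ᶠ a in 𝓝 (origin E N), mulC E N (origin E N, a) = a := by
  filter_upwards [eventually_coord_point E N] with a ha
  simpa [mulC, point_origin] using ha

end Coordinates

/-! ### Smoothness of one-parameter subgroups -/

section OneParameterSmooth

variable {E : Type*} [NormedAddCommGroup E] [NormedSpace ℝ E]
  {N : Type*} [TopologicalSpace N] [ChartedSpace E N] [Group N] [LieGroup 𝓘(ℝ, E) ∞ N]
  [CompleteSpace E] [T2Space N]

theorem hasVel_iff_hasDerivAt {f : ℝ → E} {t : ℝ} {v : E} : HasVel f t v ↔ HasDerivAt f v t := by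
  rw [HasVel, hasD_iff_hasFDerivAt, hasDerivAt_iff_hasFDerivAt,
    ContinuousLinearMap.smulRight_one_eq_toSpanSingleton]

theorem hasVel_exp_smul (x : E) (t : ℝ) :
    HasVel (fun t : ℝ ↦ exp E N (t • x)) t (lif x (exp E N (t • x))) :=
  isMIntegralCurve_exp_smul x t

theorem continuous_exp_smul (x : E) : Continuous (fun t : ℝ ↦ exp E N (t • x)) :=
  (isMIntegralCurve_exp_smul x).continuous

theorem hasDerivAt_coord_exp_smul (x : E) :
    HasDerivAt (fun t : ℝ ↦ coord E N (exp E N (t • x))) x 0 := by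
  rw [← hasVel_iff_hasDerivAt]
  have h := hasVel_exp_smul (N := N) x 0
  rw [zero_smul, exp_zero, lif_one] at h
  have h2 : HasD (coord E N) (exp E N ((0 : ℝ) • x)) (ContinuousLinearMap.id ℝ E) := by
    simpa [exp_zero] using hasD_coord E N
  exact h2.hasVel h

/-- One-parameter subgroups are smooth. In coordinates near `1` they solve the autonomous equation
`f' = ∂₂ m (f, 1) x`, where `m` is the multiplication. -/
theorem contMDiff_exp_smul (x : E) :
    ContMDiff 𝓘(ℝ, ℝ) 𝓘(ℝ, E) ∞ (fun t : ℝ ↦ exp E N (t • x)) := by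
  set f : ℝ → E := fun t ↦ coord E N (exp E N (t • x)) with hf
  have hT : Filter.Tendsto (fun t : ℝ ↦ exp E N (t • x)) (𝓝 0) (𝓝 1) := by
    simpa [exp_zero] using (continuous_exp_smul (N := N) x).tendsto 0
  have hf0 : f 0 = origin E N := by simp [hf, exp_zero, origin]
  have hfT : Filter.Tendsto f (𝓝 0) (𝓝 (origin E N)) := (continuousAt_coord E N).tendsto.comp hT
  have hpf : ∀ᶠ t in 𝓝 (0 : ℝ), point N (f t) = exp E N (t • x) :=
    hT.eventually (eventually_point_coord E N)
  have hi : Filter.Tendsto (fun a : E ↦ (a, origin E N)) (𝓝 (origin E N))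
      (𝓝 (origin E N, origin E N)) := (Continuous.prodMk_left (origin E N)).tendsto _
  have hmd : ∀ᶠ a in 𝓝 (origin E N), DifferentiableAt ℝ (mulC E N) (a, origin E N) := by
    have := ((contDiffAt_mulC E N).of_le (m := 1) (by simp)).eventually (by simp)
    filter_upwards [hi.eventually this] with a ha
    exact ha.differentiableAt (by simp)
  -- the velocity of the curve at `t` is the translate of its velocity at `0`
  have hder : ∀ᶠ t in 𝓝 (0 : ℝ),
      HasDerivAt f (fderiv ℝ (mulC E N) (f t, origin E N) (0, x)) t := by
    filter_upwards [hfT.eventually hmd, hpf] with t h1 h2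
    have h3 : HasDerivAt (fun s ↦ mulC E N (f t, f s))
        (fderiv ℝ (mulC E N) (f t, origin E N) (0, x)) 0 := by
      refine HasFDerivAt.comp_hasDerivAt_of_eq (0 : ℝ) h1.hasFDerivAt
        ((hasDerivAt_const _ _).prodMk (hasDerivAt_coord_exp_smul x)) (by simp [← hf0, hf])
    have h4 : HasDerivAt (fun s ↦ f (t + s))
        (fderiv ℝ (mulC E N) (f t, origin E N) (0, x)) 0 := by
      refine h3.congr_of_eventuallyEq ?_
      filter_upwards [hpf] with s hs
      change coord E N (exp E N ((t + s) • x)) = coord E N (point N (f t) * point N (f s))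
      rw [h2, hs, exp_add_smul]
    have := (HasDerivAt.comp_sub_const t t (f := fun s ↦ f (t + s)) (by simpa using h4))
    simpa using this
  have hfs : ContDiffAt ℝ ∞ f 0 := by
    refine contDiffAt_of_hasDerivAt_comp
      (V := fun a ↦ fderiv ℝ (mulC E N) (a, origin E N) (0, x)) hder ?_
    rw [hf0]
    have h1 : ContDiffAt ℝ ∞ (fderiv ℝ (mulC E N)) (origin E N, origin E N) :=
      (contDiffAt_mulC E N).fderiv_right (by simp)
    have h2 : ContDiffAt ℝ ∞ (fun a ↦ fderiv ℝ (mulC E N) (a, origin E N)) (origin E N) :=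
      ContDiffAt.comp (origin E N) h1 (contDiffAt_id.prodMk contDiffAt_const)
    exact h2.clm_apply contDiffAt_const
  have h0 : ContMDiffAt 𝓘(ℝ, ℝ) 𝓘(ℝ, E) ∞ (fun t : ℝ ↦ exp E N (t • x)) 0 := by
    have h1 : ContMDiffAt 𝓘(ℝ, ℝ) 𝓘(ℝ, E) ∞ (fun t : ℝ ↦ point N (f t)) 0 := by
      refine ContMDiffAt.comp (0 : ℝ) ?_ hfs.contMDiffAt
      rw [hf0]; exact contMDiffAt_point E N
    exact h1.congr_of_eventuallyEq (hpf.mono fun t ht ↦ ht.symm)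
  intro t
  have h1 : ContMDiffAt 𝓘(ℝ, ℝ) 𝓘(ℝ, E) ∞ (fun s : ℝ ↦ exp E N ((s - t) • x)) t := by
    refine ContMDiffAt.comp (f := fun s : ℝ ↦ s - t) (g := fun s : ℝ ↦ exp E N (s • x)) t ?_
      (contDiffAt_id.sub contDiffAt_const).contMDiffAt
    simpa using h0
  have h2 : (fun s : ℝ ↦ exp E N (s • x)) = fun s ↦ exp E N (t • x) * exp E N ((s - t) • x) := by
    ext s
    rw [← exp_add_smul]; simp
  rw [h2]
  exact ContMDiffAt.comp t (contMDiff_mul_left (I := 𝓘(ℝ, E)) (n := ∞)).contMDiffAt h1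

end OneParameterSmooth

/-! ### The Lie bracket in coordinates -/

section BracketInCoordinates

variable (E : Type*) [NormedAddCommGroup E] [NormedSpace ℝ E] [CompleteSpace E]
  (N : Type*) [TopologicalSpace N] [ChartedSpace E N] [Group N] [LieGroup 𝓘(ℝ, E) ∞ N]

/-- The Lie bracket of the Lie algebra of `N`, as a bilinear map on `E`. -/
def br : E →ₗ[ℝ] E →ₗ[ℝ] E :=
  letI L := GroupLieAlgebra 𝓘(ℝ, E) N
  LinearMap.mk₂ ℝ (fun x y : E ↦ @Bracket.bracket L L _ x y)
    (fun x y z ↦ add_lie (L := L) (M := L) x y z) (fun c x y ↦ smul_lie (L := L) (M := L) c x y)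
    (fun x y z ↦ lie_add (L := L) (M := L) x y z) (fun c x y ↦ lie_smul (L := L) (M := L) c x y)

theorem br_self (x : E) : br E N x x = 0 := lie_self (L := GroupLieAlgebra 𝓘(ℝ, E) N) x

theorem mem_center_iff (x : E) : x ∈ center E N ↔ ∀ y, br E N y x = 0 := Iff.rfl

variable {E N} in
theorem IsTwoStep.br_mem (h : IsTwoStep E N) (x y : E) : br E N x y ∈ center E N := h x y

variable {E} in
/-- A left-invariant field in the coordinates `coord`. -/
def lifC (x a : E) : E := fderiv ℝ (mulC E N) (a, origin E N) (0, x)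

theorem eventually_hasFDerivAt_mulC_right : ∀ᶠ a in 𝓝 (origin E N),
    DifferentiableAt ℝ (mulC E N) (a, origin E N) := by
  have hi : Filter.Tendsto (fun a : E ↦ (a, origin E N)) (𝓝 (origin E N))
      (𝓝 (origin E N, origin E N)) := (Continuous.prodMk_left (origin E N)).tendsto _
  have := ((contDiffAt_mulC E N).of_le (m := 1) (by simp)).eventually (by simp)
  filter_upwards [hi.eventually this] with a ha
  exact ha.differentiableAt (by simp)

variable {E} in
/-- The coordinate field `lifC x` represents the left-invariant field `lif x`. -/
theorem eventually_lif_point : ∀ᶠ a in 𝓝 (origin E N), ∀ x,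
    lif x (point N a) = D E E (point N) a (lifC N x a) := by
  filter_upwards [eventually_hasFDerivAt_mulC_right E N, contMDiffAt_point_eventually E N,
    (isOpen_extChartAt_target (I := 𝓘(ℝ, E)) (1 : N)).mem_nhds
      (mem_extChartAt_target (I := 𝓘(ℝ, E)) (1 : N)), mulC_origin_right E N] with a h1 h2 h3 h4 x
  -- both sides are the derivative of `b ↦ point a * point b`
  have e1 : HasD (fun b : E ↦ point N a * point N b) (origin E N)
      (D E E (fun n : N ↦ point N a * n) 1) := by
    have := (hasD_mul_left (E := E) (point N a) 1).comp_of_eq (hasD_point E N) (point_origin E N)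
    simpa using this
  have e2 : HasD (fun b : E ↦ mulC E N (a, b)) (origin E N)
      ((fderiv ℝ (mulC E N) (a, origin E N)).comp (ContinuousLinearMap.inr ℝ E E)) := by
    rw [hasD_iff_hasFDerivAt]
    exact h1.hasFDerivAt.comp (origin E N) (hasFDerivAt_prodMk_right a (origin E N))
  have e3 : HasD (fun b : E ↦ point N (mulC E N (a, b))) (origin E N)
      ((D E E (point N) a).comp
        ((fderiv ℝ (mulC E N) (a, origin E N)).comp (ContinuousLinearMap.inr ℝ E E))) :=
    (hasD_of_contMDiffAt h2).comp_of_eq e2 h4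
  have e4 : (fun b : E ↦ point N a * point N b) =ᶠ[𝓝 (origin E N)]
      (fun b : E ↦ point N (mulC E N (a, b))) := by
    have hc : Filter.Tendsto (fun b : E ↦ point N a * point N b) (𝓝 (origin E N))
        (𝓝 (point N a)) := by
      have := HasMFDerivAt.continuousAt e1
      simpa [ContinuousAt, point_origin] using this
    have hs : (extChartAt 𝓘(ℝ, E) (1 : N)).source ∈ 𝓝 (point N a) :=
      (isOpen_extChartAt_source (I := 𝓘(ℝ, E)) (1 : N)).mem_nhds
        ((extChartAt 𝓘(ℝ, E) (1 : N)).map_target h3)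
    filter_upwards [hc.eventually hs] with b hb
    exact ((extChartAt 𝓘(ℝ, E) (1 : N)).left_inv hb).symm
  have := congrArg (fun A : E →L[ℝ] E ↦ A x) (e1.unique (e3.congr e4))
  rw [lif_eq_D]
  exact this

/-- The derivative of the parametrization `point`, as it occurs in the definition of the Lie
bracket of vector fields on manifolds. -/
def pointDeriv (a : E) : E →L[ℝ] E :=
  mfderivWithin 𝓘(ℝ, E) 𝓘(ℝ, E) (extChartAt 𝓘(ℝ, E) (1 : N)).symm (Set.range 𝓘(ℝ, E)) a

theorem pointDeriv_eq (a : E) : pointDeriv E N a = D E E (point N) a := by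
  rw [pointDeriv, modelWithCornersSelf_coe, Set.range_id, mfderivWithin_univ]; rfl

theorem eventually_pointDeriv_isInvertible :
    ∀ᶠ a in 𝓝 (origin E N), (pointDeriv E N a).IsInvertible := by
  filter_upwards [extChartAt_target_mem_nhds (I := 𝓘(ℝ, E)) (1 : N)] with a h2
  exact isInvertible_mfderivWithin_extChartAt_symm (I := 𝓘(ℝ, E)) h2

variable {E} in
/-- The coordinate expression of the Lie bracket of two left-invariant fields. -/
theorem br_eq_lieBracket (x y : E) :
    br E N x y = VectorField.lieBracket ℝ (lifC N x) (lifC N y) (origin E N) := by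
  have hV : ∀ x : E, (fun a ↦ (pointDeriv E N a).inverse (lif x (point N a)))
      =ᶠ[𝓝 (origin E N)] lifC N x := by
    intro x
    filter_upwards [eventually_lif_point N, eventually_pointDeriv_isInvertible E N] with a ha h2
    obtain ⟨A, hA⟩ := h2
    rw [ha x, ← pointDeriv_eq, ← hA, ContinuousLinearMap.inverse_equiv]
    exact A.symm_apply_apply _
  have h1 : br E N x y = (D E E (coord E N) 1).inverse
      (VectorField.lieBracketWithin ℝ
        (fun a ↦ (pointDeriv E N a).inverse (lif x (point N a)))
        (fun a ↦ (pointDeriv E N a).inverse (lif y (point N a)))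
        ((extChartAt 𝓘(ℝ, E) (1 : N)).symm ⁻¹' Set.univ ∩ Set.range 𝓘(ℝ, E)) (origin E N)) := rfl
  have hset : ((extChartAt 𝓘(ℝ, E) (1 : N)).symm ⁻¹' Set.univ ∩ Set.range 𝓘(ℝ, E)) =
      Set.univ := by simp
  rw [h1, (hasD_coord E N).D_eq, ContinuousLinearMap.inverse_id, hset,
    VectorField.lieBracketWithin_univ]
  exact Filter.EventuallyEq.lieBracket_vectorField_eq (hV x) (hV y)

end BracketInCoordinates

/-! ### The adjoint representation -/

section Adjoint

variable {E : Type*} [NormedAddCommGroup E] [NormedSpace ℝ E]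
  {N : Type*} [TopologicalSpace N] [ChartedSpace E N] [Group N]

/-- The adjoint representation of `N` on its Lie algebra. -/
def Ad (g : N) : E →L[ℝ] E := D E E (fun h : N ↦ g * h * g⁻¹) 1

variable [LieGroup 𝓘(ℝ, E) ∞ N]

theorem hasD_conj (g : N) : HasD (fun h : N ↦ g * h * g⁻¹) 1 (Ad (E := E) g) :=
  hasD_of_contMDiff (((contMDiff_mul_left (I := 𝓘(ℝ, E)) (n := ∞) (a := g))).mul
    contMDiff_const) 1

theorem Ad_one : Ad (E := E) (1 : N) = ContinuousLinearMap.id ℝ E := by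
  have h : (fun h : N ↦ 1 * h * 1⁻¹) = fun h ↦ h := by ext; simp
  rw [Ad, h]
  exact (hasD_id E (1 : N)).D_eq

theorem Ad_mul (g h : N) : Ad (E := E) (g * h) = (Ad g).comp (Ad h) := by
  have h1 : (fun n : N ↦ g * h * n * (g * h)⁻¹) = fun n ↦ g * (h * n * h⁻¹) * g⁻¹ := by
    ext; group
  rw [Ad, h1]
  exact ((hasD_conj g).comp_of_eq (hasD_conj h) (by simp)).D_eq

/-- A right translate of a left-invariant field is left-invariant. -/
theorem D_mul_right_lif (g h : N) (x : E) :
    D E E (fun n : N ↦ n * h) g (lif x g) = lif (Ad h⁻¹ x) (g * h) := by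
  have h1 : HasD (fun n : N ↦ g * n * h) 1
      ((D E E (fun n : N ↦ n * h) g).comp (D E E (fun n : N ↦ g * n) 1)) :=
    (hasD_mul_right h g).comp_of_eq (hasD_mul_left g 1) (mul_one g)
  have h2 : HasD (fun n : N ↦ g * h * (h⁻¹ * n * h⁻¹⁻¹)) 1
      ((D E E (fun n : N ↦ g * h * n) 1).comp (Ad h⁻¹)) :=
    (hasD_mul_left (g * h) 1).comp_of_eq (hasD_conj h⁻¹) (by simp)
  have h3 : (fun n : N ↦ g * h * (h⁻¹ * n * h⁻¹⁻¹)) = fun n ↦ g * n * h := by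
    ext; group
  rw [h3] at h2
  exact congrArg (fun A : E →L[ℝ] E ↦ A x) (h1.unique h2)

end Adjoint

/-! ### The derivative of the adjoint representation -/

section AdjointDerivative

variable (E : Type*) [NormedAddCommGroup E] [NormedSpace ℝ E] [CompleteSpace E]
  (N : Type*) [TopologicalSpace N] [ChartedSpace E N] [Group N] [LieGroup 𝓘(ℝ, E) ∞ N]

/-- The second derivative at `(1, 1)` of the multiplication in the coordinates `coord`. -/
def hessMul : E × E →L[ℝ] E × E →L[ℝ] E :=
  fderiv ℝ (fderiv ℝ (mulC E N)) (origin E N, origin E N)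

theorem hasFDerivAt_fderiv_mulC :
    HasFDerivAt (fderiv ℝ (mulC E N)) (hessMul E N) (origin E N, origin E N) :=
  (((contDiffAt_mulC E N).fderiv_right (m := ∞) (by simp)).differentiableAt
    (by simp)).hasFDerivAt

theorem hessMul_symm (p q : E × E) : hessMul E N p q = hessMul E N q p :=
  (contDiffAt_mulC E N).isSymmSndFDerivAt
    (by rw [minSmoothness_of_isRCLikeNormedField]; exact ENat.LEInfty.out) p q

theorem differentiableAt_mulC : DifferentiableAt ℝ (mulC E N) (origin E N, origin E N) :=
  (contDiffAt_mulC E N).differentiableAt (by simp)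

theorem fderiv_mulC_left (u : E) :
    fderiv ℝ (mulC E N) (origin E N, origin E N) (u, 0) = u := by
  have h1 : HasFDerivAt (fun a : E ↦ mulC E N (a, origin E N)) _ (origin E N) :=
    HasFDerivAt.comp (f := fun a : E ↦ (a, origin E N)) (origin E N)
      (differentiableAt_mulC E N).hasFDerivAt (hasFDerivAt_prodMk_left (origin E N) (origin E N))
  have h2 := (hasFDerivAt_id (𝕜 := ℝ) (origin E N)).congr_of_eventuallyEq
    (mulC_origin_right E N)
  exact congrArg (fun A : E →L[ℝ] E ↦ A u) (h1.unique h2)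

theorem fderiv_mulC_right (u : E) :
    fderiv ℝ (mulC E N) (origin E N, origin E N) (0, u) = u := by
  have h1 : HasFDerivAt (fun a : E ↦ mulC E N (origin E N, a)) _ (origin E N) :=
    (differentiableAt_mulC E N).hasFDerivAt.comp (origin E N)
      (hasFDerivAt_prodMk_right (origin E N) (origin E N))
  have h2 := (hasFDerivAt_id (𝕜 := ℝ) (origin E N)).congr_of_eventuallyEq
    (mulC_origin_left E N)
  exact congrArg (fun A : E →L[ℝ] E ↦ A u) (h1.unique h2)

theorem hasFDerivAt_lifC (x : E) :
    HasFDerivAt (lifC N x) (((ContinuousLinearMap.apply ℝ E ((0, x) : E × E)).comp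
      (hessMul E N)).comp (ContinuousLinearMap.inl ℝ E E)) (origin E N) := by
  have h1 := HasFDerivAt.comp (f := fun a : E ↦ (a, origin E N)) (origin E N)
    (hasFDerivAt_fderiv_mulC E N) (hasFDerivAt_prodMk_left (origin E N) (origin E N))
  exact (ContinuousLinearMap.apply ℝ E ((0, x) : E × E)).hasFDerivAt.comp (origin E N) h1

/-- The bracket is the antisymmetrized mixed second derivative of the multiplication at `(1, 1)`. -/
theorem br_eq_hessMul (x y : E) :
    br E N x y = hessMul E N (x, 0) (0, y) - hessMul E N (y, 0) (0, x) := by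
  rw [br_eq_lieBracket, VectorField.lieBracket, (hasFDerivAt_lifC E N x).fderiv,
    (hasFDerivAt_lifC E N y).fderiv]
  simp [lifC, fderiv_mulC_right]

variable {E} in
theorem eventually_Ad_point : ∀ᶠ a in 𝓝 (origin E N), Ad (point N a) =
    (fderiv ℝ (conjC E N) (a, origin E N)).comp (ContinuousLinearMap.inr ℝ E E) := by
  have hi : Filter.Tendsto (fun a : E ↦ (a, origin E N)) (𝓝 (origin E N))
      (𝓝 (origin E N, origin E N)) := (Continuous.prodMk_left (origin E N)).tendsto _
  have := ((contDiffAt_conjC E N).of_le (m := 1) (by simp)).eventually (by simp)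
  filter_upwards [hi.eventually this] with a ha
  have h1 : HasD (fun b : E ↦ coord E N (point N a * point N b * (point N a)⁻¹)) (origin E N)
      ((ContinuousLinearMap.id ℝ E).comp ((Ad (point N a)).comp (ContinuousLinearMap.id ℝ E))) :=
    (hasD_coord E N).comp_of_eq
      ((hasD_conj (point N a)).comp_of_eq (hasD_point E N) (point_origin E N))
      (by simp [point_origin])
  rw [hasD_iff_hasFDerivAt] at h1
  exact h1.unique ((ha.differentiableAt (by simp)).hasFDerivAt.comp (origin E N)
    (hasFDerivAt_prodMk_right a (origin E N)))

theorem conjC_origin (a : E) : conjC E N (a, origin E N) = origin E N := by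
  rw [conjC]
  simp only [point_origin]
  simp [origin]

/-- The derivative in `b` of the identity `(a b a⁻¹) a = a b`. -/
theorem eventually_fderiv_mulC_Ad : ∀ᶠ a in 𝓝 (origin E N), ∀ y,
    fderiv ℝ (mulC E N) (origin E N, a) (Ad (point N a) y, 0) =
      fderiv ℝ (mulC E N) (a, origin E N) (0, y) := by
  have hi : Filter.Tendsto (fun a : E ↦ (origin E N, a)) (𝓝 (origin E N))
      (𝓝 (origin E N, origin E N)) := (Continuous.prodMk_right (origin E N)).tendsto _
  have hi' : Filter.Tendsto (fun a : E ↦ (a, origin E N)) (𝓝 (origin E N))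
      (𝓝 (origin E N, origin E N)) := (Continuous.prodMk_left (origin E N)).tendsto _
  have hm := ((contDiffAt_mulC E N).of_le (m := 1) (by simp)).eventually (by simp)
  have hc := ((contDiffAt_conjC E N).of_le (m := 1) (by simp)).eventually (by simp)
  have h1 : ContinuousAt (fun p : E × E ↦ point N p.1) (origin E N, origin E N) :=
    ContinuousAt.comp (x := (origin E N, origin E N)) (continuousAt_point E N) continuousAt_fst
  have h2 : ContinuousAt (fun p : E × E ↦ point N p.2) (origin E N, origin E N) :=
    ContinuousAt.comp (x := (origin E N, origin E N)) (continuousAt_point E N) continuousAt_snd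
  have : IsTopologicalGroup N := topologicalGroup_of_lieGroup 𝓘(ℝ, E) ∞
  have hT : Filter.Tendsto (fun p : E × E ↦ point N p.1 * point N p.2 * (point N p.1)⁻¹)
      (𝓝 (origin E N, origin E N)) (𝓝 1) := by
    have := ((h1.mul h2).mul h1.inv).tendsto
    simpa [point_origin] using! this
  have hpc : ∀ᶠ a in 𝓝 (origin E N), ∀ᶠ b in 𝓝 (origin E N),
      mulC E N (conjC E N (a, b), a) = mulC E N (a, b) := by
    refine Filter.Eventually.curry_nhds
      (p := fun p : E × E ↦ mulC E N (conjC E N p, p.1) = mulC E N p) ?_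
    filter_upwards [hT.eventually (eventually_point_coord E N)] with p hp
    simp only [mulC, conjC]
    rw [hp, inv_mul_cancel_right]
  filter_upwards [hpc, hi.eventually hm, hi'.eventually hm, hi'.eventually hc,
    eventually_Ad_point N] with a h3 h4 h5 h6 h7 y
  have e1 : HasFDerivAt (fun b : E ↦ mulC E N (a, b)) _ (origin E N) :=
    (h5.differentiableAt (by simp)).hasFDerivAt.comp (origin E N)
      (hasFDerivAt_prodMk_right a (origin E N))
  have e2 : HasFDerivAt (fun b : E ↦ conjC E N (a, b)) (Ad (point N a)) (origin E N) := by
    rw [h7]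
    exact (h6.differentiableAt (by simp)).hasFDerivAt.comp (origin E N)
      (hasFDerivAt_prodMk_right a (origin E N))
  have e3 : HasFDerivAt (fun b : E ↦ mulC E N (conjC E N (a, b), a))
      ((fderiv ℝ (mulC E N) (origin E N, a)).comp ((Ad (point N a)).prod 0)) (origin E N) := by
    have e4 : HasFDerivAt (mulC E N) (fderiv ℝ (mulC E N) (origin E N, a))
        (conjC E N (a, origin E N), a) := by
      rw [conjC_origin]
      exact (h4.differentiableAt (by simp)).hasFDerivAt
    exact HasFDerivAt.comp (f := fun b : E ↦ (conjC E N (a, b), a)) (origin E N) e4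
      (e2.prodMk (hasFDerivAt_const a (origin E N)))
  have := congrArg (fun A : E →L[ℝ] E ↦ A y) ((e3.congr_of_eventuallyEq
    (h3.mono fun b hb ↦ hb.symm)).unique e1)
  simpa using this

/-- The derivative of the adjoint representation at `1` is the Lie bracket: differentiating the
identity of `eventually_fderiv_mulC_Ad` in `a` expresses the derivative in terms of the second
derivative of the multiplication, as in `br_eq_hessMul`. -/
theorem exists_hasFDerivAt_Ad_point (y : E) :
    ∃ T : E →L[ℝ] E, HasFDerivAt (fun a ↦ Ad (point N a) y) T (origin E N) ∧
      ∀ x, T x = br E N x y := by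
  have h1 : DifferentiableAt ℝ (fun a ↦ Ad (point N a) y) (origin E N) := by
    have e1 : DifferentiableAt ℝ (fun a ↦ fderiv ℝ (conjC E N) (a, origin E N) (0, y))
        (origin E N) := by
      have e2 : DifferentiableAt ℝ (fderiv ℝ (conjC E N)) (origin E N, origin E N) :=
        ((contDiffAt_conjC E N).fderiv_right (m := ∞) (by simp)).differentiableAt (by simp)
      have e3 := DifferentiableAt.comp (f := fun a : E ↦ (a, origin E N)) (origin E N) e2
        (hasFDerivAt_prodMk_left (origin E N) (origin E N)).differentiableAt
      exact e3.clm_apply (differentiableAt_const _)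
    refine e1.congr_of_eventuallyEq ?_
    filter_upwards [eventually_Ad_point N] with a ha
    rw [ha]; rfl
  refine ⟨_, h1.hasFDerivAt, fun x ↦ ?_⟩
  set T := fderiv ℝ (fun a ↦ Ad (point N a) y) (origin E N)
  have h2 := HasFDerivAt.comp (f := fun a : E ↦ (origin E N, a)) (origin E N)
    (hasFDerivAt_fderiv_mulC E N) (hasFDerivAt_prodMk_right (origin E N) (origin E N))
  have h3 : HasFDerivAt (fun a ↦ fderiv ℝ (mulC E N) (origin E N, a) (Ad (point N a) y, 0)) _
      (origin E N) := h2.clm_apply (h1.hasFDerivAt.prodMk (hasFDerivAt_const (0 : E) _))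
  have h4 := (hasFDerivAt_lifC E N y).congr_of_eventuallyEq
    ((eventually_fderiv_mulC_Ad E N).mono fun a ha ↦ ha y)
  have h5 := congrArg (fun A : E →L[ℝ] E ↦ A x) (h3.unique h4)
  simp [point_origin, Ad_one] at h5
  rw [fderiv_mulC_left] at h5
  rw [br_eq_hessMul, ← h5, hessMul_symm E N (0, x) (y, 0)]
  abel

end AdjointDerivative

/-! ### Velocities of products of curves -/

section Curves

variable {E : Type*} [NormedAddCommGroup E] [NormedSpace ℝ E]
  {N : Type*} [TopologicalSpace N] [ChartedSpace E N] [Group N] [LieGroup 𝓘(ℝ, E) ∞ N]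

/-- The product rule for curves in a Lie group. -/
theorem HasVel.mul {γ δ : ℝ → N} {t : ℝ} {u w : E} (hγ : HasVel γ t u) (hδ : HasVel δ t w) :
    HasVel (fun s ↦ γ s * δ s) t
      (D E E (fun n : N ↦ n * δ t) (γ t) u + D E E (fun n : N ↦ γ t * n) (δ t) w) := by
  have hm : MDifferentiableAt (𝓘(ℝ, E).prod 𝓘(ℝ, E)) 𝓘(ℝ, E) (fun p : N × N ↦ p.1 * p.2)
      (γ t, δ t) := (contMDiff_mul 𝓘(ℝ, E) ∞).mdifferentiable (by simp) _
  have h1 := HasMFDerivAt.comp t hm.hasMFDerivAt (HasMFDerivAt.prodMk hγ hδ)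
  refine HasMFDerivAt.congr_mfderiv h1 ?_
  refine ContinuousLinearMap.ext_ring ?_
  refine (mfderiv_prod_eq_add_apply hm).trans ?_
  change D E E (fun n : N ↦ n * δ t) (γ t) ((1 : ℝ) • u) +
    D E E (fun n : N ↦ γ t * n) (δ t) ((1 : ℝ) • w) = (1 : ℝ) • _
  simp only [one_smul]

/-- The velocity of a product of two curves, in terms of left logarithmic derivatives. -/
theorem HasVel.mul_lif {γ δ : ℝ → N} {t : ℝ} {u w : E} (hγ : HasVel γ t (lif u (γ t)))
    (hδ : HasVel δ t (lif w (δ t))) :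
    HasVel (fun s ↦ γ s * δ s) t (lif (Ad (δ t)⁻¹ u + w) (γ t * δ t)) := by
  have := hγ.mul hδ
  rwa [D_mul_right_lif, D_mul_left_lif, ← lif_add] at this

theorem HasVel.comp_hasDerivAt {X : Type*} [TopologicalSpace X] [ChartedSpace E X] {γ : ℝ → X}
    {f : ℝ → ℝ} {t a : ℝ} {v : E} (hγ : HasVel γ (f t) v) (hf : HasDerivAt f a t) :
    HasVel (fun s ↦ γ (f s)) t (a • v) := by
  have := HasD.hasVel hγ (hasVel_iff_hasDerivAt.2 hf)
  simpa using this

variable [CompleteSpace E] [T2Space N]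

theorem eq_of_hasVel_zero {γ : ℝ → N} (h : ∀ t, HasVel γ t (0 : E)) (s t : ℝ) : γ s = γ t := by
  have h1 : IsMIntegralCurve (I := 𝓘(ℝ, E)) γ (lif 0) := fun t ↦ by
    have := h t
    rw [← lif_zero (γ t)] at this
    exact this
  have h2 : IsMIntegralCurve (I := 𝓘(ℝ, E)) (fun _ ↦ γ t) (lif 0) := fun s ↦ by
    have : HasVel (fun _ : ℝ ↦ γ t) s (lif (0 : E) (γ t)) := by
      rw [lif_zero, HasVel, ContinuousLinearMap.smulRight_one_eq_toSpanSingleton,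
        ContinuousLinearMap.toSpanSingleton_zero]
      exact hasD_const _ _
    exact this
  exact congrFun (eq_of_integralCurve_lif (t₀ := t) h1 h2 rfl) s

end Curves

/-! ### The Baker–Campbell–Hausdorff formula -/

section BCH

variable {E : Type*} [NormedAddCommGroup E] [NormedSpace ℝ E]
  {N : Type*} [TopologicalSpace N] [ChartedSpace E N] [Group N] [LieGroup 𝓘(ℝ, E) ∞ N]
  [CompleteSpace E] [T2Space N]

theorem hasDerivAt_Ad_exp_zero (x y : E) :
    HasDerivAt (fun s : ℝ ↦ Ad (exp E N (s • x)) y) (br E N x y) 0 := by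
  obtain ⟨T, hT, h⟩ := exists_hasFDerivAt_Ad_point E N y
  rw [← h]
  have h0 : origin E N = coord E N (exp E N ((0 : ℝ) • x)) := by simp [exp_zero, origin]
  have h1 : HasDerivAt (fun s : ℝ ↦ Ad (point N (coord E N (exp E N (s • x)))) y) (T x) 0 :=
    HasFDerivAt.comp_hasDerivAt_of_eq (0 : ℝ) hT (hasDerivAt_coord_exp_smul x) h0
  refine h1.congr_of_eventuallyEq ?_
  have hT : Filter.Tendsto (fun t : ℝ ↦ exp E N (t • x)) (𝓝 0) (𝓝 1) := by
    simpa [exp_zero] using (continuous_exp_smul (N := N) x).tendsto 0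
  filter_upwards [hT.eventually (eventually_point_coord E N)] with s hs
  rw [hs]

theorem hasDerivAt_Ad_exp (x y : E) (t : ℝ) :
    HasDerivAt (fun s : ℝ ↦ Ad (exp E N (s • x)) y) (Ad (exp E N (t • x)) (br E N x y)) t := by
  have h1 := (Ad (exp E N (t • x))).hasFDerivAt.comp_hasDerivAt (0 : ℝ)
    (hasDerivAt_Ad_exp_zero (N := N) x y)
  have h2 := HasDerivAt.comp_sub_const t t (by simpa using h1)
  refine h2.congr_of_eventuallyEq (Filter.Eventually.of_forall fun s ↦ ?_)
  have : s • x = (t + (s - t)) • x := by simp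
  simp only [Function.comp_apply]
  rw [this, exp_add_smul, Ad_mul]
  rfl

/-- If `[x, y] = 0`, the curve `Ad (exp (t x)) y` has derivative `Ad (exp (t x)) [x, y] = 0`. -/
theorem Ad_exp_of_br_eq_zero {x y : E} (h : br E N x y = 0) (t : ℝ) :
    Ad (exp E N (t • x)) y = y := by
  have hd : ∀ s, HasDerivAt (fun s : ℝ ↦ Ad (exp E N (s • x)) y) 0 s := fun s ↦ by
    simpa [h] using hasDerivAt_Ad_exp (N := N) x y s
  have := is_const_of_deriv_eq_zero (fun s ↦ (hd s).differentiableAt) (fun s ↦ (hd s).deriv) t 0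
  simpa [exp_zero, Ad_one] using this

/-- As `[x, y]` commutes with `x`, the curve `Ad (exp (t x)) y` has constant derivative `[x, y]`. -/
theorem IsTwoStep.Ad_exp_smul (hN : IsTwoStep E N) (x y : E) (t : ℝ) :
    Ad (exp E N (t • x)) y = y + t • br E N x y := by
  have hd : ∀ s, HasDerivAt (fun s : ℝ ↦ Ad (exp E N (s • x)) y - s • br E N x y) 0 s := by
    intro s
    have h1 := hasDerivAt_Ad_exp (N := N) x y s
    rw [Ad_exp_of_br_eq_zero ((mem_center_iff E N _).1 (hN.br_mem x y) x)] at h1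
    exact (h1.sub ((hasDerivAt_id s).smul_const (br E N x y))).congr_deriv (by simp)
  have := is_const_of_deriv_eq_zero (fun s ↦ (hd s).differentiableAt) (fun s ↦ (hd s).deriv) t 0
  simp only [zero_smul, exp_zero, Ad_one, sub_zero] at this
  exact sub_eq_iff_eq_add.1 this

theorem br_swap (x y : E) : br E N x y = -br E N y x := by
  have := br_self E N (x + y)
  simp only [map_add, LinearMap.add_apply, br_self] at this
  rw [eq_neg_iff_add_eq_zero]
  simpa [add_comm] using this

theorem IsTwoStep.br_br (hN : IsTwoStep E N) (x y z : E) : br E N x (br E N y z) = 0 :=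
  hN.br_mem y z x

theorem IsTwoStep.br_br' (hN : IsTwoStep E N) (x y z : E) : br E N (br E N y z) x = 0 := by
  rw [br_swap, hN.br_br, neg_zero]

/-- The curve `exp (t x) exp (t y) exp (-t (x + y)) exp (-t² / 2 [x, y])` has velocity zero. -/
theorem IsTwoStep.exp_mul_exp_aux (hN : IsTwoStep E N) (x y : E) :
    exp E N x * exp E N y = exp E N ((1 / 2 : ℝ) • br E N x y) * exp E N (x + y) := by
  set z := br E N x y with hz
  have h : ∀ t : ℝ, HasVel (fun t : ℝ ↦ exp E N (t • x) * exp E N (t • y) *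
      exp E N ((-t) • (x + y)) * exp E N ((-(t ^ 2 / 2)) • z)) t (0 : E) := by
    intro t
    have h1 := (hasVel_exp_smul (N := N) x t).mul_lif (hasVel_exp_smul y t)
    have e1 : Ad (exp E N (t • y))⁻¹ x + y = x + y + t • z := by
      rw [← exp_neg, ← neg_smul, hN.Ad_exp_smul, br_swap y x]
      simp; abel
    rw [e1] at h1
    have h2 : HasVel (fun t : ℝ ↦ exp E N ((-t) • (x + y))) t
        (lif (-(x + y)) (exp E N ((-t) • (x + y)))) := by
      have := (hasVel_exp_smul (N := N) (x + y) (-t)).comp_hasDerivAt (hasDerivAt_neg t)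
      rwa [← lif_smul, neg_one_smul] at this
    have h3 := h1.mul_lif h2
    have e2 : Ad (exp E N ((-t) • (x + y)))⁻¹ (x + y + t • z) + -(x + y) = t • z := by
      rw [← exp_neg, neg_smul, neg_neg, hN.Ad_exp_smul, map_add (br E N (x + y)), br_self,
        map_smul, hz, hN.br_br]
      simp only [add_zero, smul_zero, neg_add_rev]
      abel
    rw [e2] at h3
    have h4 : HasVel (fun t : ℝ ↦ exp E N ((-(t ^ 2 / 2)) • z)) t
        (lif (-(t • z)) (exp E N ((-(t ^ 2 / 2)) • z))) := by
      have hd : HasDerivAt (fun t : ℝ ↦ -(t ^ 2 / 2)) (-t) t := by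
        exact ((hasDerivAt_pow 2 t).div_const 2).neg.congr_deriv (by simp)
      have := (hasVel_exp_smul (N := N) z (-(t ^ 2 / 2))).comp_hasDerivAt
        (f := fun t : ℝ ↦ -(t ^ 2 / 2)) hd
      rwa [← lif_smul, neg_smul] at this
    have h5 := h3.mul_lif h4
    have e3 : Ad (exp E N ((-(t ^ 2 / 2)) • z))⁻¹ (t • z) + -(t • z) = 0 := by
      rw [← exp_neg, neg_smul, neg_neg, hN.Ad_exp_smul, map_smul, br_self]
      simp
    rw [e3] at h5
    rwa [lif_zero] at h5
  have h1 := eq_of_hasVel_zero h 1 0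
  simp only [one_smul, zero_smul, neg_zero, exp_zero, neg_smul, exp_neg] at h1
  have e : ∀ a b c : N, a * b⁻¹ * c⁻¹ = 1 → a = c * b := by
    intro a b c h
    rw [mul_inv_eq_one, mul_inv_eq_iff_eq_mul] at h
    exact h
  refine e _ _ _ ?_
  convert! h1 using 3 <;> norm_num [exp_zero]

/-- The Baker–Campbell–Hausdorff formula for a 2-step nilpotent Lie group. -/
theorem IsTwoStep.exp_mul_exp (hN : IsTwoStep E N) (x y : E) :
    exp E N x * exp E N y = exp E N (x + y + (1 / 2 : ℝ) • br E N x y) := by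
  rw [hN.exp_mul_exp_aux, hN.exp_mul_exp_aux ((1 / 2 : ℝ) • br E N x y)]
  simp [hN.br_br', exp_zero, add_comm]

end BCH

/-! ### Smoothness and differential of the exponential map -/

section ExpSmooth

variable {E : Type*} [NormedAddCommGroup E] [NormedSpace ℝ E]
  {N : Type*} [TopologicalSpace N] [ChartedSpace E N] [Group N] [LieGroup 𝓘(ℝ, E) ∞ N]
  [CompleteSpace E] [T2Space N]

theorem IsTwoStep.exp_add_of_mem_center (hN : IsTwoStep E N) (x : E) {z : E}
    (hz : z ∈ center E N) : exp E N (x + z) = exp E N x * exp E N z := by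
  rw [hN.exp_mul_exp, (mem_center_iff E N z).1 hz x]
  simp

theorem contMDiff_exp_comp_smul {f : E → ℝ} (hf : ContDiff ℝ ∞ f) (x : E) :
    ContMDiff 𝓘(ℝ, E) 𝓘(ℝ, E) ∞ (fun a ↦ exp E N (f a • x)) :=
  (contMDiff_exp_smul x).comp hf.contMDiff

theorem IsTwoStep.contMDiff_exp_sum_center (hN : IsTwoStep E N) {ι : Type*} (s : Finset ι)
    {f : ι → E → ℝ} (hf : ∀ i, ContDiff ℝ ∞ (f i)) {c : ι → E} (hc : ∀ i, c i ∈ center E N) :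
    ContMDiff 𝓘(ℝ, E) 𝓘(ℝ, E) ∞ (fun a ↦ exp E N (∑ i ∈ s, f i a • c i)) := by
  classical
  induction s using Finset.induction_on with
  | empty => simpa using contMDiff_const
  | insert k s hk ih =>
    have h : (fun a ↦ exp E N (∑ i ∈ insert k s, f i a • c i)) =
        fun a ↦ exp E N (f k a • c k) * exp E N (∑ i ∈ s, f i a • c i) := by
      ext a
      rw [Finset.sum_insert hk, hN.exp_add_of_mem_center]
      exact Submodule.sum_mem _ fun i _ ↦ Submodule.smul_mem _ _ (hc i)
    rw [h]
    exact (contMDiff_exp_comp_smul (hf k) _).mul ih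

/-- The exponential map is smooth in linear coordinates, being a product of one-parameter subgroups
up to a central factor that is again of this form. -/
theorem IsTwoStep.contMDiff_exp_sum (hN : IsTwoStep E N) {ι : Type*} (s : Finset ι)
    {f : ι → E → ℝ} (hf : ∀ i, ContDiff ℝ ∞ (f i)) (e : ι → E) :
    ContMDiff 𝓘(ℝ, E) 𝓘(ℝ, E) ∞ (fun a ↦ exp E N (∑ i ∈ s, f i a • e i)) := by
  classical
  induction s using Finset.induction_on with
  | empty => simpa using contMDiff_const
  | insert k s hk ih =>
    have h : (fun a ↦ exp E N (∑ i ∈ insert k s, f i a • e i)) =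
        fun a ↦ exp E N (f k a • e k) * exp E N (∑ i ∈ s, f i a • e i) *
          exp E N (∑ i ∈ s, (-(1 / 2) * (f k a * f i a)) • br E N (e k) (e i)) := by
      ext a
      have hz : ∑ i ∈ s, (-(1 / 2) * (f k a * f i a)) • br E N (e k) (e i) ∈ center E N :=
        Submodule.sum_mem _ fun i _ ↦ Submodule.smul_mem _ _ (hN.br_mem _ _)
      rw [Finset.sum_insert hk, hN.exp_mul_exp, ← hN.exp_add_of_mem_center _ hz]
      have hs : ∑ i ∈ s, (-(1 / 2) * (f k a * f i a)) • br E N (e k) (e i) =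
          -((1 / 2 : ℝ) • br E N (f k a • e k) (∑ i ∈ s, f i a • e i)) := by
        simp only [map_smul, LinearMap.smul_apply, map_sum, Finset.smul_sum,
          ← Finset.sum_neg_distrib]
        exact Finset.sum_congr rfl fun i _ ↦ by module
      rw [hs, add_neg_cancel_right]
    rw [h]
    refine ((contMDiff_exp_comp_smul (hf k) _).mul ih).mul
      (hN.contMDiff_exp_sum_center s (fun i ↦ ?_) fun i ↦ hN.br_mem _ _)
    exact contDiff_const.mul ((hf k).mul (hf i))

variable [FiniteDimensional ℝ E]

theorem IsTwoStep.contMDiff_exp (hN : IsTwoStep E N) :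
    ContMDiff 𝓘(ℝ, E) 𝓘(ℝ, E) ∞ (exp E N) := by
  let b := Module.finBasis ℝ E
  have h := hN.contMDiff_exp_sum Finset.univ (f := fun i a ↦ b.coord i a)
    (fun i ↦ (b.coord i).toContinuousLinearMap.contDiff) b
  simpa [b.sum_repr] using h

/-- The differential of the exponential map at `0` is the identity. -/
theorem IsTwoStep.hasD_exp_zero (hN : IsTwoStep E N) :
    HasD (exp E N) 0 (ContinuousLinearMap.id ℝ E) := by
  have h := hasD_of_contMDiff hN.contMDiff_exp 0
  have h1 : D E E (exp E N) 0 = ContinuousLinearMap.id ℝ E := by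
    ext x
    have h2 : HasVel (fun t : ℝ ↦ t • x) 0 x := by
      rw [hasVel_iff_hasDerivAt]
      simpa using (hasDerivAt_id (0 : ℝ)).smul_const x
    have h3 : HasD (exp E N) ((0 : ℝ) • x) (D E E (exp E N) 0) := by simpa using h
    have h4 := HasD.hasVel (γ := fun t : ℝ ↦ t • x) h3 h2
    have h5 := hasVel_exp_smul (N := N) x 0
    rw [zero_smul, exp_zero, lif_one] at h5
    simpa using congrArg (fun A : ℝ →L[ℝ] E ↦ A 1) (h4.unique h5)
  rwa [h1] at h

/-- The differential of the exponential map of a 2-step nilpotent group. It follows from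
`exp x = exp a * exp ((x - a) - [a, x - a] / 2)` and the value `id` of the differential at `0`. -/
theorem IsTwoStep.exists_hasD_exp (hN : IsTwoStep E N) (a : E) :
    ∃ A : E →L[ℝ] E, HasD (exp E N) a A ∧
      ∀ h, A h = lif (h - (1 / 2 : ℝ) • br E N a h) (exp E N a) := by
  let b : E →L[ℝ] E := (br E N a).toContinuousLinearMap
  have h1 : HasD (fun x : E ↦ (x - a) - (1 / 2 : ℝ) • b (x - a)) a
      (ContinuousLinearMap.id ℝ E - (1 / 2 : ℝ) • b.comp (ContinuousLinearMap.id ℝ E)) := by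
    rw [hasD_iff_hasFDerivAt]
    have h0 : HasFDerivAt (fun x : E ↦ x - a) (ContinuousLinearMap.id ℝ E) a :=
      (hasFDerivAt_id a).sub_const a
    exact h0.sub ((b.hasFDerivAt.comp a h0).const_smul (1 / 2 : ℝ))
  have h2 := hN.hasD_exp_zero.comp_of_eq h1 (by simp)
  have h3 := (hasD_mul_left (E := E) (exp E N a) 1).comp_of_eq h2 (by simp [exp_zero])
  refine ⟨_, h3.congr (Filter.Eventually.of_forall fun x ↦ ?_), fun h ↦ rfl⟩
  change exp E N x = exp E N a * exp E N (x - a - (1 / 2 : ℝ) • b (x - a))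
  rw [hN.exp_mul_exp]
  congr 1
  simp only [b, LinearMap.coe_toContinuousLinearMap', map_sub, br_self, map_smul, hN.br_br,
    map_zero]
  module

end ExpSmooth

/-! ### The group law on a 2-step nilpotent Lie algebra -/

section BCHGroup

variable {E : Type*} [NormedAddCommGroup E] [NormedSpace ℝ E]

/-- The group law on a 2-step nilpotent Lie algebra given by the Baker–Campbell–Hausdorff
formula. -/
@[reducible]
def bchGroup (b : E →ₗ[ℝ] E →ₗ[ℝ] E) (h1 : ∀ x, b x x = 0) (h2 : ∀ x y z, b x (b y z) = 0)
    (h3 : ∀ x y z, b (b y z) x = 0) : Group E where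
  mul x y := x + y + (1 / 2 : ℝ) • b x y
  one := 0
  inv x := -x
  mul_assoc x y z := by
    change x + y + (1 / 2 : ℝ) • b x y + z + (1 / 2 : ℝ) • b (x + y + (1 / 2 : ℝ) • b x y) z =
      x + (y + z + (1 / 2 : ℝ) • b y z) + (1 / 2 : ℝ) • b x (y + z + (1 / 2 : ℝ) • b y z)
    simp only [map_add, map_smul, LinearMap.add_apply, LinearMap.smul_apply, h2, h3]
    module
  one_mul x := by
    change 0 + x + (1 / 2 : ℝ) • b 0 x = x
    simp
  mul_one x := by
    change x + 0 + (1 / 2 : ℝ) • b x 0 = x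
    simp
  inv_mul_cancel x := by
    change -x + x + (1 / 2 : ℝ) • b (-x) x = 0
    simp [h1]

end BCHGroup

/-! ### The exponential map is a diffeomorphism -/

section ExpDiffeo

variable {E : Type*} [NormedAddCommGroup E] [NormedSpace ℝ E]
  {N : Type*} [TopologicalSpace N] [ChartedSpace E N] [Group N] [LieGroup 𝓘(ℝ, E) ∞ N]
  [CompleteSpace E] [T2Space N] [FiniteDimensional ℝ E]

/-- The exponential map has a smooth local inverse near `1`. -/
theorem IsTwoStep.exists_local_log (hN : IsTwoStep E N) : ∃ l : N → E,
    ContMDiffAt 𝓘(ℝ, E) 𝓘(ℝ, E) ∞ l 1 ∧ l 1 = 0 ∧ (∀ᶠ n in 𝓝 1, exp E N (l n) = n) ∧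
      ∀ᶠ x in 𝓝 0, l (exp E N x) = x := by
  have e0 : coord E N (exp E N 0) = origin E N := by rw [exp_zero]; rfl
  have hF : ContDiffAt ℝ ∞ (fun x : E ↦ coord E N (exp E N x)) 0 := by
    rw [← contMDiffAt_iff_contDiffAt]
    refine ContMDiffAt.comp (0 : E) ?_ (hN.contMDiff_exp 0)
    rw [exp_zero]; exact contMDiffAt_coord E N
  have hF' : HasFDerivAt (fun x : E ↦ coord E N (exp E N x))
      ((ContinuousLinearEquiv.refl ℝ E : E ≃L[ℝ] E) : E →L[ℝ] E) 0 := by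
    rw [← hasD_iff_hasFDerivAt]
    exact (hasD_coord E N).comp_of_eq hN.hasD_exp_zero (exp_zero E N)
  have hn : (∞ : WithTop ℕ∞) ≠ 0 := by simp
  have hs := hF.hasStrictFDerivAt' hF' hn
  have hc : Filter.Tendsto (exp E N) (𝓝 0) (𝓝 1) := by
    simpa [exp_zero] using hN.contMDiff_exp.continuous.tendsto (0 : E)
  refine ⟨fun n ↦ hF.localInverse hF' hn (coord E N n), ?_, ?_, ?_, ?_⟩
  · have h1 := (hF.to_localInverse hF' hn).contMDiffAt
    exact ContMDiffAt.comp (1 : N) (by rwa [e0] at h1) (contMDiffAt_coord E N)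
  · have := hF.localInverse_apply_image hF' hn
    rw [e0] at this
    exact this
  · have h1 := hs.eventually_right_inverse
    have h2 : Filter.Tendsto (hs.localInverse _ _ _) (𝓝 (origin E N)) (𝓝 0) := by
      have := hs.localInverse_continuousAt.tendsto
      rwa [hs.localInverse_apply_image, e0] at this
    rw [e0] at h1
    have h3 := (h2.comp (continuousAt_coord E N).tendsto)
    filter_upwards [(continuousAt_coord E N).tendsto.eventually h1,
      (hc.comp h3).eventually (eventually_point_coord E N), eventually_point_coord E N]
      with n e1 e2 e3
    change exp E N (hs.localInverse _ _ _ (coord E N n)) = n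
    simp only [Function.comp_apply] at e2
    rw [← e2, e1, e3]
  · exact hs.eventually_left_inverse

/-- The range of the exponential map is a subgroup, which contains a neighborhood of `1`. -/
theorem IsTwoStep.exp_surjective [ConnectedSpace N] (hN : IsTwoStep E N) :
    Function.Surjective (exp E N) := by
  have : IsTopologicalGroup N := topologicalGroup_of_lieGroup 𝓘(ℝ, E) ∞
  let H : Subgroup N :=
    { carrier := Set.range (exp E N)
      mul_mem' := by
        rintro _ _ ⟨x, rfl⟩ ⟨y, rfl⟩
        exact ⟨_, (hN.exp_mul_exp x y).symm⟩
      one_mem' := ⟨0, exp_zero E N⟩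
      inv_mem' := by
        rintro _ ⟨x, rfl⟩
        exact ⟨-x, exp_neg x⟩ }
  obtain ⟨l, -, -, h, -⟩ := hN.exists_local_log
  have hH : IsOpen (H : Set N) :=
    Subgroup.isOpen_of_mem_nhds H (g := 1) (h.mono fun n hn ↦ ⟨l n, hn⟩)
  have hH' := IsClopen.eq_univ ⟨H.isClosed_of_isOpen hH, hH⟩ ⟨1, H.one_mem⟩
  intro n
  have : n ∈ (H : Set N) := by rw [hH']; trivial
  exact this

theorem continuous_bilin (b : E →ₗ[ℝ] E →ₗ[ℝ] E) : Continuous (fun p : E × E ↦ b p.1 p.2) := by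
  have := b.toContinuousBilinearMap.continuous₂
  exact this

/-- The exponential map is a covering homomorphism from `𝔫` with the Baker–Campbell–Hausdorff
group law, so it is injective when `N` is simply connected. -/
theorem IsTwoStep.exp_injective [SimplyConnectedSpace N] (hN : IsTwoStep E N) :
    Function.Injective (exp E N) := by
  have hNg : IsTopologicalGroup N := topologicalGroup_of_lieGroup 𝓘(ℝ, E) ∞
  let _ : Group E := bchGroup (br E N) (br_self E N) hN.br_br hN.br_br'
  have hcb := continuous_bilin (br E N)
  have : IsTopologicalGroup E :=
    { continuous_mul := (continuous_fst.add continuous_snd).add (hcb.const_smul (1 / 2 : ℝ))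
      continuous_inv := continuous_neg }
  let f : E →* N :=
    { toFun := exp E N
      map_one' := exp_zero E N
      map_mul' := fun x y ↦ (hN.exp_mul_exp x y).symm }
  have hfc : Continuous f := hN.contMDiff_exp.continuous
  obtain ⟨l, hl, hl1, h1, h2⟩ := hN.exists_local_log
  have hfo : IsOpenMap f := by
    rw [IsTopologicalGroup.isOpenMap_iff_nhds_one]
    intro t ht
    have ht' : exp E N ⁻¹' t ∈ 𝓝 (l 1) := by rw [hl1]; exact ht
    filter_upwards [hl.continuousAt.preimage_mem_nhds ht', h1] with n hn hn'
    have : exp E N (l n) ∈ t := hn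
    rwa [hn'] at this
  have hq : Topology.IsQuotientMap f := hfo.isQuotientMap hfc hN.exp_surjective
  have hd : IsDiscrete (f.ker : Set E) := by
    have : DiscreteTopology f.ker := by
      obtain ⟨U, hU, hUo, h0⟩ := eventually_nhds_iff.1 h2
      refine discreteTopology_of_isOpen_singleton_one ⟨U, hUo, ?_⟩
      ext x
      refine ⟨fun hx ↦ Subtype.ext ?_, fun hx ↦ ?_⟩
      · have hx1 : exp E N x = 1 := x.2
        have := hU x hx
        rw [hx1, hl1] at this
        exact this.symm
      · rw [Set.mem_singleton_iff.1 hx]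
        exact h0
    exact ⟨this⟩
  have hcov := (hq.isQuotientCoveringMap_of_isDiscrete_ker_monoidHom hd).isCoveringMap
  have : LocallyPathConnectedSpace N := ChartedSpace.locallyPathConnectedSpace E N
  obtain ⟨F, ⟨hF1, hF2⟩, -⟩ := hcov.existsUnique_continuousMap_lifts (ContinuousMap.id N) 1 (0 : E)
    (exp_zero E N)
  have h3 : (fun x ↦ F (f x)) = id := by
    refine hcov.eq_of_comp_eq (F.continuous.comp hfc) continuous_id ?_ 0 ?_
    · ext x
      exact congrFun hF2 (f x)
    · have : f 0 = 1 := exp_zero E N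
      rw [this, hF1]; rfl
  exact Function.LeftInverse.injective (g := F) (congrFun h3)

theorem IsTwoStep.exp_bijective [SimplyConnectedSpace N] (hN : IsTwoStep E N) :
    Function.Bijective (exp E N) :=
  ⟨hN.exp_injective, hN.exp_surjective⟩

/-- The inverse of the exponential map. -/
def IsTwoStep.log [SimplyConnectedSpace N] (hN : IsTwoStep E N) : N → E :=
  (Equiv.ofBijective _ hN.exp_bijective).symm

theorem IsTwoStep.exp_log [SimplyConnectedSpace N] (hN : IsTwoStep E N) (n : N) :
    exp E N (hN.log n) = n :=
  (Equiv.ofBijective _ hN.exp_bijective).apply_symm_apply n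

theorem IsTwoStep.log_exp [SimplyConnectedSpace N] (hN : IsTwoStep E N) (x : E) :
    hN.log (exp E N x) = x :=
  (Equiv.ofBijective _ hN.exp_bijective).symm_apply_apply x

/-- Near `exp a`, the logarithm is the Baker–Campbell–Hausdorff product of `a` and the local
logarithm of `exp (-a) n`. -/
theorem IsTwoStep.contMDiff_log [SimplyConnectedSpace N] (hN : IsTwoStep E N) :
    ContMDiff 𝓘(ℝ, E) 𝓘(ℝ, E) ∞ hN.log := by
  intro n
  obtain ⟨a, rfl⟩ := hN.exp_surjective n
  obtain ⟨l, hl, hl1, h1, h2⟩ := hN.exists_local_log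
  let b : E →L[ℝ] E := (br E N a).toContinuousLinearMap
  have hT : ContMDiff 𝓘(ℝ, E) 𝓘(ℝ, E) ∞ (fun m : N ↦ (exp E N a)⁻¹ * m) := contMDiff_mul_left
  have e0 : (exp E N a)⁻¹ * exp E N a = 1 := inv_mul_cancel _
  have h3 : ContMDiffAt 𝓘(ℝ, E) 𝓘(ℝ, E) ∞ (fun m : N ↦ l ((exp E N a)⁻¹ * m)) (exp E N a) :=
    ContMDiffAt.comp (exp E N a) (by rwa [e0]) (hT (exp E N a))
  have h4 : ContDiff ℝ ∞ (fun x : E ↦ a + x + (1 / 2 : ℝ) • b x) :=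
    (contDiff_const.add contDiff_id).add (b.contDiff.const_smul _)
  have h5 := ContMDiffAt.comp (exp E N a) (h4.contMDiff _) h3
  refine h5.congr_of_eventuallyEq ?_
  have hT' := (hT.continuous.tendsto (exp E N a))
  rw [e0] at hT'
  filter_upwards [hT'.eventually h1] with m hm
  apply hN.exp_injective
  rw [hN.exp_log]
  change m = exp E N (a + l ((exp E N a)⁻¹ * m) + (1 / 2 : ℝ) • br E N a (l ((exp E N a)⁻¹ * m)))
  rw [← hN.exp_mul_exp, hm, mul_inv_cancel_left]

end ExpDiffeo

/-! ### Smooth quotients of manifolds -/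

section QuotientManifold

variable {E : Type*} [NormedAddCommGroup E] [NormedSpace ℝ E]
  {F : Type*} [NormedAddCommGroup F] [NormedSpace ℝ F]
  {X : Type*} [TopologicalSpace X] [ChartedSpace E X]
  {Y : Type*} [TopologicalSpace Y] [ChartedSpace F Y]
  {Q : Type*} [TopologicalSpace Q] [ChartedSpace E Q]

/-- `p` is the projection onto the quotient of a manifold by smooth transformations, and the charts
of the quotient are those obtained from local inverses of `p`. -/
structure IsSmoothQuotient (p : X → Q) : Prop where
  isLocalHomeomorph : IsLocalHomeomorph p
  surjective : Function.Surjective p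
  charts : ‹ChartedSpace E Q› = isLocalHomeomorph.chartedSpace surjective
  deck : ∀ x x', p x = p x' →
    ∃ d : X → X, ContMDiff 𝓘(ℝ, E) 𝓘(ℝ, E) ∞ d ∧ d x = x' ∧ ∀ y, p (d y) = p y

namespace IsSmoothQuotient

variable {p : X → Q} (hp : IsSmoothQuotient (E := E) p)

/-- The preferred chart at a point of the quotient comes from a local inverse of `p` and a
preferred chart upstairs. -/
theorem exists_chart (q : Q) : ∃ x₀ : X, p x₀ = q ∧
    (∀ q', extChartAt 𝓘(ℝ, E) q q' =
      extChartAt 𝓘(ℝ, E) x₀ (hp.isLocalHomeomorph.localInverseAt x₀ q')) ∧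
    ∀ a, (extChartAt 𝓘(ℝ, E) q).symm a = p ((extChartAt 𝓘(ℝ, E) x₀).symm a) := by
  obtain ⟨hl, hs, rfl, -⟩ := hp
  exact ⟨hs.hasRightInverse.choose q, hs.hasRightInverse.choose_spec q, fun q' ↦ rfl, fun a ↦
    congrFun (hl.localInverseAt_symm (hs.hasRightInverse.choose q)) _⟩

/-- Two lifts to `X` of the same map agree near a point where they agree. -/
theorem eventually_eq_of_lift {Z : Type*} [TopologicalSpace Z] {f g : Z → X} {z : Z}
    (hl : IsLocalHomeomorph p) (hf : ContinuousAt f z) (hg : ContinuousAt g z) (h : f z = g z)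
    (hfg : ∀ᶠ w in 𝓝 z, p (f w) = p (g w)) : f =ᶠ[𝓝 z] g := by
  have ht := (hl.localInverseAt (f z)).open_target.mem_nhds
    (hl.self_mem_localInverseAt_target (x := f z))
  have ht' : (hl.localInverseAt (f z)).target ∈ 𝓝 (g z) := h ▸ ht
  filter_upwards [hfg, hf.eventually ht, hg.eventually ht'] with w h1 h2 h3
  exact hl.injOn_localInverseAt_target h2 h3 h1

theorem continuousAt_localInverseAt (hl : IsLocalHomeomorph p) (x : X) :
    ContinuousAt (hl.localInverseAt x) (p x) :=
  (hl.localInverseAt x).continuousAt hl.apply_self_mem_localInverseAt_source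

theorem eventually_apply_localInverseAt (hl : IsLocalHomeomorph p) (x : X) :
    ∀ᶠ q in 𝓝 (p x), p (hl.localInverseAt x q) = q := by
  filter_upwards [(hl.localInverseAt x).open_source.mem_nhds
    hl.apply_self_mem_localInverseAt_source] with q hq
  exact hl.apply_localInverseAt_of_mem hq

variable [IsManifold 𝓘(ℝ, E) ∞ X]
include hp

theorem contMDiff : ContMDiff 𝓘(ℝ, E) 𝓘(ℝ, E) ∞ p := by
  intro x
  have hl := hp.isLocalHomeomorph
  rw [contMDiffAt_iff_target]
  refine ⟨hl.continuous.continuousAt, ?_⟩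
  obtain ⟨x₀, hx₀, hc, -⟩ := hp.exists_chart (p x)
  obtain ⟨d, hd, hdx, hpd⟩ := hp.deck x x₀ hx₀.symm
  have h1 : (fun y ↦ hl.localInverseAt x₀ (p y)) =ᶠ[𝓝 x] d := by
    refine eventually_eq_of_lift hl ?_ hd.continuous.continuousAt ?_ ?_
    · refine ContinuousAt.comp (x := x) ?_ hl.continuous.continuousAt
      rw [← hx₀]; exact continuousAt_localInverseAt hl x₀
    · rw [← hx₀, hl.localInverseAt_apply_self, hdx]
    · have := eventually_apply_localInverseAt hl x₀
      rw [hx₀] at this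
      filter_upwards [hl.continuous.continuousAt.eventually this] with y hy
      rw [hpd, hy]
  have h2 : ContMDiffAt 𝓘(ℝ, E) 𝓘(ℝ, E) ∞ (fun y ↦ extChartAt 𝓘(ℝ, E) x₀ (d y)) x := by
    refine ContMDiffAt.comp x ?_ (hd x)
    rw [hdx]; exact contMDiffAt_extChartAt
  refine h2.congr_of_eventuallyEq ?_
  filter_upwards [h1] with y hy
  rw [Function.comp_apply, hc, ← hy]

/-- The projection onto a smooth quotient has smooth local sections. -/
theorem exists_section (x : X) : ∃ s : Q → X, s (p x) = x ∧
    ContMDiffAt 𝓘(ℝ, E) 𝓘(ℝ, E) ∞ s (p x) ∧ (∀ᶠ q in 𝓝 (p x), p (s q) = q) ∧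
    ∀ᶠ y in 𝓝 x, s (p y) = y := by
  have hl := hp.isLocalHomeomorph
  obtain ⟨x₀, hx₀, hc, hc'⟩ := hp.exists_chart (p x)
  obtain ⟨d, hd, hdx, hpd⟩ := hp.deck x₀ x hx₀
  have e0 : extChartAt 𝓘(ℝ, E) (p x) (p x) = extChartAt 𝓘(ℝ, E) x₀ x₀ := by
    rw [hc, ← hx₀, hl.localInverseAt_apply_self]
  have hloc : ContMDiffAt 𝓘(ℝ, E) 𝓘(ℝ, E) ∞ (hl.localInverseAt x₀) (p x) := by
    rw [contMDiffAt_iff_source, e0]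
    have h1 : ContMDiffAt 𝓘(ℝ, E) 𝓘(ℝ, E) ∞ (extChartAt 𝓘(ℝ, E) x₀).symm
        (extChartAt 𝓘(ℝ, E) x₀ x₀) :=
      (contMDiffOn_extChartAt_symm (I := 𝓘(ℝ, E)) (n := ∞) x₀).contMDiffAt
        (extChartAt_target_mem_nhds x₀)
    refine (h1.congr_of_eventuallyEq ?_).contMDiffWithinAt
    have ht := (hl.localInverseAt x₀).open_target.mem_nhds
      (hl.self_mem_localInverseAt_target (x := x₀))
    have h2 : ContinuousAt (extChartAt 𝓘(ℝ, E) x₀).symm (extChartAt 𝓘(ℝ, E) x₀ x₀) :=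
      h1.continuousAt
    rw [ContinuousAt, extChartAt_to_inv] at h2
    filter_upwards [h2.eventually ht] with a ha
    rw [Function.comp_apply, hc']
    have h3 := (hl.localInverseAt x₀).right_inv ha
    rwa [congrFun (hl.localInverseAt_symm x₀)] at h3
  have e1 : hl.localInverseAt x₀ (p x) = x₀ := by rw [← hx₀, hl.localInverseAt_apply_self]
  have hs : ContMDiffAt 𝓘(ℝ, E) 𝓘(ℝ, E) ∞ (fun q ↦ d (hl.localInverseAt x₀ q)) (p x) :=
    ContMDiffAt.comp (p x) (hd _) hloc
  have hps : ∀ᶠ q in 𝓝 (p x), p (d (hl.localInverseAt x₀ q)) = q := by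
    have := eventually_apply_localInverseAt hl x₀
    rw [hx₀] at this
    filter_upwards [this] with q hq
    rw [hpd, hq]
  have e2 : d (hl.localInverseAt x₀ (p x)) = x := by rw [e1, hdx]
  refine ⟨fun q ↦ d (hl.localInverseAt x₀ q), e2, hs, hps, ?_⟩
  refine eventually_eq_of_lift (g := fun y ↦ y) hl
    (ContinuousAt.comp (g := fun q ↦ d (hl.localInverseAt x₀ q)) (x := x) hs.continuousAt
      hl.continuous.continuousAt) continuousAt_id
    e2 ?_
  exact hl.continuous.continuousAt.eventually hps

theorem hasD (x : X) : HasD p x (D E E p x) := hasD_of_contMDiff hp.contMDiff x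

theorem isInvertible_D (x : X) : (D E E p x).IsInvertible := by
  obtain ⟨s, hsx, hs, h1, h2⟩ := hp.exists_section x
  have hs' := hasD_of_contMDiffAt hs
  have hp' := hp.hasD x
  refine ContinuousLinearMap.IsInvertible.of_inverse (g := D E E s (p x)) ?_ ?_
  · have h3 : HasD p (s (p x)) (D E E p x) := by rwa [hsx]
    exact ((h3.comp hs').congr (h1.mono fun q hq ↦ hq.symm)).unique (hasD_id E (p x))
  · exact ((hs'.comp hp').congr (h2.mono fun q hq ↦ hq.symm)).unique (hasD_id E x)

/-- A map out of a smooth quotient is smooth if its lift is. -/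
theorem contMDiff_of_comp {f : Q → Y} (hf : ContMDiff 𝓘(ℝ, E) 𝓘(ℝ, F) ∞ (fun x ↦ f (p x))) :
    ContMDiff 𝓘(ℝ, E) 𝓘(ℝ, F) ∞ f := by
  intro q
  obtain ⟨x, rfl⟩ := hp.surjective q
  obtain ⟨s, hsx, hs, h1, -⟩ := hp.exists_section x
  have h2 : ContMDiffAt 𝓘(ℝ, E) 𝓘(ℝ, F) ∞ (fun q ↦ f (p (s q))) (p x) :=
    ContMDiffAt.comp (g := fun x ↦ f (p x)) (p x) (hf _) hs
  refine h2.congr_of_eventuallyEq ?_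
  filter_upwards [h1] with q hq
  rw [hq]

/-- The metric tensor that descends from an invariant metric tensor makes `p` a local isometry. -/
theorem descendedMetric_apply (hs : Function.Surjective p) (g : MetricTensor E X)
    (hg : ∀ x x', p x = p x' → ∃ d : X → X, ContMDiff 𝓘(ℝ, E) 𝓘(ℝ, E) ∞ d ∧ d x = x' ∧
      (∀ y, p (d y) = p y) ∧ ∀ u v : E, g x' (D E E d x u) (D E E d x v) = g x u v)
    (x : X) (u v : E) :
    descendedMetric p hs g (p x) (D E E p x u) (D E E p x v) = g x u v := by
  set x' := Function.surjInv hs (p x) with hx'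
  obtain ⟨d, hd, hdx, hpd, hgd⟩ := hg x x' (Function.surjInv_eq hs (p x)).symm
  have h1 : D E E p x = (D E E p x').comp (D E E d x) := by
    have h2 := (hp.hasD x').comp_of_eq (hasD_of_contMDiff hd x) hdx
    simp only [hpd] at h2
    exact h2.D_eq
  have h2 : ∀ w, (D E E p x').inverse (D E E p x w) = D E E d x w := by
    intro w
    obtain ⟨A, hA⟩ := hp.isInvertible_D x'
    rw [h1, ← hA, ContinuousLinearMap.inverse_equiv]
    exact A.symm_apply_apply _
  have h3 : descendedMetric p hs g (p x) (D E E p x u) (D E E p x v) =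
      g x' ((D E E p x').inverse (D E E p x u)) ((D E E p x').inverse (D E E p x v)) := rfl
  rw [h3, h2, h2, hgd]

end IsSmoothQuotient
end QuotientManifold

/-! ### Lattices in 2-step nilpotent Lie algebras -/

section Lattices

variable {E : Type*} [NormedAddCommGroup E] [NormedSpace ℝ E] [FiniteDimensional ℝ E]

/-- A subset whose translates of a fixed ball cover the whole space spans it. -/
theorem span_eq_top_of_bounded_dist {S : Set E} {R : ℝ} (h : ∀ x : E, ∃ s ∈ S, ‖x - s‖ ≤ R) :
    Submodule.span ℝ S = ⊤ := by
  by_contra hne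
  obtain ⟨f, hf, hle⟩ := Submodule.exists_le_ker_of_lt_top _ (lt_top_iff_ne_top.2 hne)
  refine hf (LinearMap.ext fun x ↦ ?_)
  let f' : E →L[ℝ] ℝ := f.toContinuousLinearMap
  have hb : ∀ n : ℕ, n • ‖f x‖ ≤ ‖f'‖ * R := by
    intro n
    obtain ⟨s, hs, hR⟩ := h (n • x)
    have h0 : f s = 0 := hle (Submodule.subset_span hs)
    have h1 : f' (n • x - s) = n • f x := by simp [f', h0]
    calc n • ‖f x‖ = ‖f' (n • x - s)‖ := by rw [h1]; simp
      _ ≤ ‖f'‖ * ‖n • x - s‖ := f'.le_opNorm _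
      _ ≤ ‖f'‖ * R := by gcongr
  by_contra hx
  obtain ⟨n, hn⟩ := Archimedean.arch (‖f'‖ * R + 1) (norm_pos_iff.2 hx)
  linarith [hb n]

theorem discreteTopology_of_norm_lt {W : Type*} [NormedAddCommGroup W] (A : AddSubgroup W) {ε : ℝ}
    (hε : 0 < ε) (h : ∀ a ∈ A, ‖a‖ < ε → a = 0) : DiscreteTopology A := by
  refine discreteTopology_of_isOpen_singleton_zero
    ⟨Metric.ball 0 ε, Metric.isOpen_ball, ?_⟩
  ext a
  constructor
  · intro ha
    exact Subtype.ext (h a a.2 (by simpa using ha))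
  · intro ha
    rw [Set.mem_singleton_iff.1 ha]
    simpa using hε

variable {b : E →ₗ[ℝ] E →ₗ[ℝ] E}

/-- A discrete cocompact subgroup of the group `E` with the Baker–Campbell–Hausdorff
multiplication `x + y + [x, y] / 2` of the bracket `b`. -/
structure IsBCHLattice (b : E →ₗ[ℝ] E →ₗ[ℝ] E) (G : Set E) : Prop where
  zero_mem : (0 : E) ∈ G
  neg_mem : ∀ x ∈ G, -x ∈ G
  mul_mem : ∀ x ∈ G, ∀ y ∈ G, x + y + (1 / 2 : ℝ) • b x y ∈ G
  discrete : ∃ ε > 0, ∀ x ∈ G, ‖x‖ < ε → x = 0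
  cocompact : ∃ R, ∀ x, ∃ g ∈ G, ∃ k, ‖k‖ ≤ R ∧ x = g + k + (1 / 2 : ℝ) • b g k

/-- A splitting of a 2-step nilpotent Lie algebra with bracket `b` and center `z` into the center
and a complement `v`, with the projection `π` along the center. -/
structure IsCentralSplitting (b : E →ₗ[ℝ] E →ₗ[ℝ] E) (z v : Submodule ℝ E) (π : E →ₗ[ℝ] v) :
    Prop where
  alt : ∀ x, b x x = 0
  mem_center : ∀ x, x ∈ z ↔ ∀ y, b y x = 0
  twoStep : ∀ x y, b x y ∈ z
  sub_mem : ∀ x, x - π x ∈ z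
  apply_of_mem : ∀ x ∈ z, π x = 0
  apply_coe : ∀ y : v, π y = y

namespace IsCentralSplitting

variable {z v : Submodule ℝ E} {π : E →ₗ[ℝ] v} (h : IsCentralSplitting b z v π)
include h

theorem swap (x y : E) : b x y = -b y x := by
  have := h.alt (x + y)
  simp only [map_add, LinearMap.add_apply, h.alt] at this
  rw [eq_neg_iff_add_eq_zero]
  simpa [add_comm] using this

theorem right_of_mem (x : E) {y : E} (hy : y ∈ z) : b x y = 0 := (h.mem_center y).1 hy x

theorem left_of_mem {x : E} (hx : x ∈ z) (y : E) : b x y = 0 := by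
  rw [h.swap, h.right_of_mem y hx, neg_zero]

theorem apply_proj_left (x y : E) : b (π x) y = b x y := by
  have := h.left_of_mem (h.sub_mem x) y
  rw [map_sub, LinearMap.sub_apply, sub_eq_zero] at this
  exact this.symm

theorem apply_proj_right (x y : E) : b x (π y) = b x y := by
  rw [h.swap, h.apply_proj_left, ← h.swap]

theorem proj_mul (x y : E) : π (x + y + (1 / 2 : ℝ) • b x y) = π x + π y := by
  simp [h.apply_of_mem _ (h.twoStep x y)]

theorem eq_zero_of_mem {y : v} (hy : (y : E) ∈ z) : y = 0 := by
  rw [← h.apply_coe y, h.apply_of_mem _ hy]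

end IsCentralSplitting

namespace IsBCHLattice

variable {z v : Submodule ℝ E} {π : E →ₗ[ℝ] v} {G : Set E}

/-- The central part of a lattice. -/
def central (hG : IsBCHLattice b G) (h : IsCentralSplitting b z v π) : AddSubgroup z where
  carrier := {w | (w : E) ∈ G}
  add_mem' {x y} hx hy := by
    have := hG.mul_mem x hx y hy
    rw [h.right_of_mem _ y.2] at this
    simpa using this
  zero_mem' := hG.zero_mem
  neg_mem' {x} hx := hG.neg_mem x hx

/-- The projection of a lattice. -/
def proj (hG : IsBCHLattice b G) (h : IsCentralSplitting b z v π) : AddSubgroup v where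
  carrier := π '' G
  add_mem' := by
    rintro _ _ ⟨x, hx, rfl⟩ ⟨y, hy, rfl⟩
    exact ⟨_, hG.mul_mem x hx y hy, h.proj_mul x y⟩
  zero_mem' := ⟨0, hG.zero_mem, map_zero _⟩
  neg_mem' := by
    rintro _ ⟨x, hx, rfl⟩
    exact ⟨-x, hG.neg_mem x hx, map_neg _ _⟩

variable (hG : IsBCHLattice b G) (h : IsCentralSplitting b z v π)

theorem discreteTopology_central : DiscreteTopology (hG.central h) := by
  obtain ⟨ε, hε, hd⟩ := hG.discrete
  exact discreteTopology_of_norm_lt _ hε fun a ha hn ↦ Subtype.ext (hd a ha hn)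

/-- The projection of a lattice is cocompact, hence spans. -/
theorem span_proj : Submodule.span ℝ (hG.proj h : Set v) = ⊤ := by
  obtain ⟨R, hR⟩ := hG.cocompact
  let π' : E →L[ℝ] v := π.toContinuousLinearMap
  refine span_eq_top_of_bounded_dist (R := ‖π'‖ * R) fun x ↦ ?_
  obtain ⟨g, hg, k, hk, hx⟩ := hR x
  refine ⟨π g, ⟨g, hg, rfl⟩, ?_⟩
  have h1 : x - π g = π' k := by
    rw [← h.apply_coe x, hx, h.proj_mul, add_sub_cancel_left]; rfl
  rw [h1]
  exact (π'.le_opNorm k).trans (by gcongr)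

/-- Commutators of elements of a lattice depend on their projections only. -/
theorem bracket_mem {s t : v} (hs : s ∈ hG.proj h) (ht : t ∈ hG.proj h) : b s t ∈ G := by
  obtain ⟨x, hx, rfl⟩ := hs
  obtain ⟨y, hy, rfl⟩ := ht
  rw [h.apply_proj_left, h.apply_proj_right]
  have h1 := hG.mul_mem _ (hG.mul_mem x hx y hy) _
    (hG.mul_mem _ (hG.neg_mem x hx) _ (hG.neg_mem y hy))
  convert! h1 using 1
  simp only [map_add, map_neg, map_smul, LinearMap.add_apply, LinearMap.smul_apply,
    LinearMap.neg_apply, h.right_of_mem _ (h.twoStep _ _), h.left_of_mem (h.twoStep _ _),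
    h.alt, h.swap y x]
  module

/-- Taking brackets with finitely many elements of the projected lattice which span `v` embeds it
into a power of the discrete group `G ∩ z`. -/
theorem discreteTopology_proj : DiscreteTopology (hG.proj h) := by
  obtain ⟨T, hT, hspan⟩ :=
    (Submodule.fg_span_iff_fg_span_finset_subset (R := ℝ) (hG.proj h : Set v)).1
      (IsNoetherian.noetherian _)
  rw [hG.span_proj h] at hspan
  obtain ⟨ε, hε, hd⟩ := hG.discrete
  have h1 : ∀ᶠ l : v in 𝓝 0, ∀ t ∈ T, ‖b t l‖ < ε := by
    rw [Filter.eventually_all_finset]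
    intro t _
    have hc : Continuous fun l : v ↦ ‖b t l‖ :=
      ((b t).continuous_of_finiteDimensional.comp continuous_subtype_val).norm
    have : ‖b t (0 : v)‖ < ε := by simpa using hε
    exact hc.continuousAt.eventually (gt_mem_nhds this)
  obtain ⟨δ, hδ, hball⟩ := Metric.eventually_nhds_iff.1 h1
  refine discreteTopology_of_norm_lt _ hδ fun l hl hn ↦ h.eq_zero_of_mem ?_
  have h2 : ∀ t ∈ T, b t l = 0 := fun t ht ↦
    hd _ (hG.bracket_mem h (hT ht) hl) (hball (by simpa using hn) t ht)
  have h3 : ∀ t : v, b t l = 0 := by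
    intro t
    have ht : t ∈ Submodule.span ℝ (T : Set v) := by rw [← hspan]; trivial
    induction ht using Submodule.span_induction with
    | mem t ht => exact h2 t ht
    | zero => simp
    | add x y _ _ hx hy => simp [hx, hy]
    | smul c x _ hx => simp [hx]
  rw [h.mem_center]
  intro y
  rw [← h.apply_proj_left, h3]

/-- The central part of the lattice is cocompact: an element of the group which brings a central
vector `w` into a bounded set has bounded projection, so up to finitely many choices it is
central. -/
theorem exists_central_norm_sub_le : ∃ R, ∀ w : z, ∃ a ∈ hG.central h, ‖w - a‖ ≤ R := by
  obtain ⟨R, hR⟩ := hG.cocompact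
  let π' : E →L[ℝ] v := π.toContinuousLinearMap
  have := hG.discreteTopology_proj h
  -- the projected lattice has finitely many elements in a ball
  have hfin : ((hG.proj h : Set v) ∩ Metric.closedBall 0 (‖π'‖ * R)).Finite := by
    have hc : IsClosed (hG.proj h : Set v) := AddSubgroup.isClosed_of_discrete
    rw [Set.inter_comm]
    exact Metric.finite_isBounded_inter_isClosed DiscreteTopology.isDiscrete
      Metric.isBounded_closedBall hc
  have hlift : ∀ l : v, ∃ g, l ∈ hG.proj h → g ∈ G ∧ π g = l := fun l ↦ by
    by_cases hl : l ∈ hG.proj h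
    · obtain ⟨g, hg, rfl⟩ := hl
      exact ⟨g, fun _ ↦ ⟨hg, rfl⟩⟩
    · exact ⟨0, fun h ↦ absurd h hl⟩
  choose σ hσ using hlift
  obtain ⟨R₂, hR₂⟩ := (hfin.image σ).isBounded.exists_norm_le
  have hcont : Continuous fun k : E ↦ k + (1 / 2 : ℝ) • b (-(π' k : E)) k := by
    have h1 := continuous_bilin b
    have h2 : Continuous fun k : E ↦ (-(π' k : E), k) :=
      ((continuous_subtype_val.comp π'.continuous).neg).prodMk continuous_id
    exact continuous_id.add ((h1.comp h2).const_smul (1 / 2 : ℝ))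
  obtain ⟨R₁, hR₁⟩ :=
    ((isCompact_closedBall (0 : E) R).image hcont).isBounded.exists_norm_le
  refine ⟨R₁ + R₂, fun w ↦ ?_⟩
  obtain ⟨g, hg, k, hk, hw⟩ := hR w
  have h0 : π g + π k = 0 := by
    rw [← h.proj_mul, ← hw, h.apply_of_mem _ w.2]
  have hgk : π g = -π k := eq_neg_of_add_eq_zero_left h0
  have hgL : π g ∈ hG.proj h := ⟨g, hg, rfl⟩
  have hgF : π g ∈ (hG.proj h : Set v) ∩ Metric.closedBall 0 (‖π'‖ * R) := by
    refine ⟨hgL, ?_⟩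
    rw [mem_closedBall_zero_iff, hgk, norm_neg]
    exact (π'.le_opNorm k).trans (by gcongr)
  obtain ⟨hσG, hσπ⟩ := hσ (π g) hgL
  have hσR := hR₂ _ ⟨_, hgF, rfl⟩
  -- the lattice elements `g` and `σ (π g)` differ by a central lattice element
  have hb : b g (σ (π g)) = 0 := by
    rw [← h.apply_proj_left, ← h.apply_proj_right, hσπ, h.alt]
  have hz : g - σ (π g) ∈ z := by
    have h1 := h.sub_mem (g - σ (π g))
    rwa [map_sub, hσπ, sub_self, Submodule.coe_zero, sub_zero] at h1
  have hmem : g - σ (π g) ∈ G := by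
    have := hG.mul_mem g hg _ (hG.neg_mem _ hσG)
    rw [map_neg, hb] at this
    simpa [sub_eq_add_neg] using this
  refine ⟨⟨g - σ (π g), hz⟩, hmem, ?_⟩
  have h1 : (w : E) - (g - σ (π g)) = (k + (1 / 2 : ℝ) • b (-(π' k : E)) k) + σ (π g) := by
    have h2 : (-(π' k : E)) = (π g : v) := by rw [hgk]; rfl
    rw [hw, h2, h.apply_proj_left]
    abel
  change ‖(w : E) - (g - σ (π g))‖ ≤ _
  rw [h1]
  exact (norm_add_le _ _).trans (add_le_add (hR₁ _ ⟨k, by simpa using hk, rfl⟩) hσR)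

theorem span_central : Submodule.span ℝ (hG.central h : Set z) = ⊤ :=
  let ⟨_, hR⟩ := hG.exists_central_norm_sub_le h
  span_eq_top_of_bounded_dist hR

end IsBCHLattice
end Lattices

/-! ### Quotients of vector spaces by discrete subgroups -/

section TorusQuotient

variable {W : Type*} [NormedAddCommGroup W] [NormedSpace ℝ W]

theorem Torus.mk_eq_mk_iff (Λ : AddSubgroup W) {x y : W} :
    Torus.mk Λ x = Torus.mk Λ y ↔ y - x ∈ Λ := by
  rw [← neg_add_eq_sub]
  exact QuotientAddGroup.eq

theorem Torus.mk_add_of_mem (Λ : AddSubgroup W) (x : W) {a : W} (ha : a ∈ Λ) :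
    Torus.mk Λ (x + a) = Torus.mk Λ x :=
  ((Torus.mk_eq_mk_iff Λ).2 (by simpa using ha)).symm

theorem contMDiff_add_const (a : W) : ContMDiff 𝓘(ℝ, W) 𝓘(ℝ, W) ∞ fun x : W ↦ x + a :=
  (contDiff_id.add contDiff_const).contMDiff

theorem Torus.isSmoothQuotient (Λ : AddSubgroup W) [DiscreteTopology Λ] :
    IsSmoothQuotient (E := W) (Torus.mk Λ) where
  isLocalHomeomorph := Torus.mk_isLocalHomeomorph Λ
  surjective := Torus.mk_surjective Λ
  charts := rfl
  deck x x' h := ⟨fun y ↦ y + (x' - x), contMDiff_add_const _, add_sub_cancel _ _, fun y ↦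
    Torus.mk_add_of_mem Λ y ((Torus.mk_eq_mk_iff Λ).1 h)⟩

theorem Torus.metric_mk (Λ : AddSubgroup W) [DiscreteTopology Λ] (b : LinearMap.BilinForm ℝ W)
    (x u v : W) : Torus.metric Λ b (Torus.mk Λ x) (D W W (Torus.mk Λ) x u)
      (D W W (Torus.mk Λ) x v) = b u v := by
  refine (Torus.isSmoothQuotient Λ).descendedMetric_apply (Torus.mk_surjective Λ)
    (fun _ (u v : W) ↦ b u v) (fun x x' h ↦ ⟨fun y ↦ y + (x' - x), contMDiff_add_const _,
      add_sub_cancel _ _, fun y ↦ Torus.mk_add_of_mem Λ y ((Torus.mk_eq_mk_iff Λ).1 h), ?_⟩) x u v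
  have h1 : D W W (fun y : W ↦ y + (x' - x)) x = ContinuousLinearMap.id ℝ W :=
    (hasD_iff_hasFDerivAt.2 ((hasFDerivAt_id x).add_const (x' - x))).D_eq
  intro u v
  rw [h1]
  rfl

/-- The quotient by a cocompact subgroup is compact. -/
theorem Torus.compactSpace [FiniteDimensional ℝ W] (Λ : AddSubgroup W) [DiscreteTopology Λ] {R : ℝ}
    (h : ∀ w : W, ∃ a ∈ Λ, ‖w - a‖ ≤ R) : CompactSpace (Torus Λ) := by
  have : ProperSpace W := FiniteDimensional.proper ℝ W
  have hc := (isCompact_closedBall (0 : W) R).image (Torus.isSmoothQuotient Λ).contMDiff.continuous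
  refine ⟨hc.of_isClosed_subset isClosed_univ fun q _ ↦ ?_⟩
  obtain ⟨w, rfl⟩ := Torus.mk_surjective Λ q
  obtain ⟨a, ha, hR⟩ := h w
  refine ⟨w - a, by simpa using hR, ?_⟩
  rw [sub_eq_add_neg, Torus.mk_add_of_mem Λ _ (Λ.neg_mem ha)]

end TorusQuotient

/-! ### The quotient `Γ\N` and its metric tensor -/

section LeftQuotient

variable {E : Type*} [NormedAddCommGroup E] [NormedSpace ℝ E]
  {N : Type*} [TopologicalSpace N] [ChartedSpace E N] [Group N]

theorem pN_eq_pN_iff (Γ : Subgroup N) {m n : N} : pN Γ m = pN Γ n ↔ n * m⁻¹ ∈ Γ :=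
  Quotient.eq''.trans QuotientGroup.rightRel_apply

theorem pN_mul (Γ : Subgroup N) {g : N} (hg : g ∈ Γ) (n : N) : pN Γ (g * n) = pN Γ n :=
  ((pN_eq_pN_iff Γ).2 (by simpa using hg)).symm

variable [LieGroup 𝓘(ℝ, E) ∞ N]

variable (E) in
theorem isSmoothQuotient_pN (Γ : Subgroup N) [DiscreteTopology Γ] :
    IsSmoothQuotient (E := E) (pN Γ) where
  isLocalHomeomorph := pN_isLocalHomeomorph E Γ
  surjective := pN_surjective Γ
  charts := rfl
  deck m n h := ⟨fun y ↦ n * m⁻¹ * y, contMDiff_mul_left, inv_mul_cancel_right _ _,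
    pN_mul Γ ((pN_eq_pN_iff Γ).1 h)⟩

/-- Left-invariant vector fields identify the tangent space at `n` with the Lie algebra. -/
theorem inverse_D_mul_left_lif (n : N) (x : E) :
    (D E E (fun m : N ↦ n * m) 1).inverse (lif x n) = x := by
  have h : (D E E (fun m : N ↦ n * m) 1).IsInvertible := by
    refine ContinuousLinearMap.IsInvertible.of_inverse
      (g := D E E (fun m : N ↦ n⁻¹ * m) n) ?_ ?_
    · have h1 := (hasD_mul_left (E := E) n 1).comp_of_eq (hasD_mul_left n⁻¹ n)
        (inv_mul_cancel n)
      simp only [mul_inv_cancel_left] at h1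
      exact h1.unique (hasD_id E n)
    · have h1 := (hasD_mul_left (E := E) n⁻¹ n).comp_of_eq (hasD_mul_left n 1) (mul_one n)
      simp only [inv_mul_cancel_left] at h1
      exact h1.unique (hasD_id E 1)
  obtain ⟨A, hA⟩ := h
  rw [lif_eq_D, ← hA, ContinuousLinearMap.inverse_equiv]
  exact A.symm_apply_apply x

theorem lif_injective (n : N) : Function.Injective fun x : E ↦ lif x n := fun x y h ↦ by
  rw [← inverse_D_mul_left_lif n x, ← inverse_D_mul_left_lif n y]
  exact congrArg _ h

theorem exists_lif_eq (n : N) (u : E) : ∃ x : E, lif x n = u := by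
  refine ⟨D E E (fun m : N ↦ n⁻¹ * m) n u, ?_⟩
  have h1 := (hasD_mul_left (E := E) n 1).comp_of_eq (hasD_mul_left n⁻¹ n) (inv_mul_cancel n)
  simp only [mul_inv_cancel_left] at h1
  exact DFunLike.congr_fun (h1.unique (hasD_id E n)) u

theorem leftInvariantMetric_lif (B : LinearMap.BilinForm ℝ E) (n : N) (x y : E) :
    leftInvariantMetric E B n (lif x n : E) (lif y n : E) = B x y := by
  have h : leftInvariantMetric E B n (lif x n : E) (lif y n : E) =
    B ((D E E (fun m : N ↦ n * m) 1).inverse (lif x n : E))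
      ((D E E (fun m : N ↦ n * m) 1).inverse (lif y n : E)) := rfl
  rw [h, inverse_D_mul_left_lif, inverse_D_mul_left_lif]

/-- The left-invariant fields have constant inner products in `Γ\N`. -/
theorem quotMetric_frame (Γ : Subgroup N) [DiscreteTopology Γ] (B : LinearMap.BilinForm ℝ E)
    (n : N) (x y : E) : quotMetric E Γ B (pN Γ n) (frame Γ x n) (frame Γ y n) = B x y := by
  rw [← leftInvariantMetric_lif B n x y]
  refine (isSmoothQuotient_pN E Γ).descendedMetric_apply (pN_surjective Γ)
    (leftInvariantMetric E B) (fun m n h ↦ ⟨fun y ↦ n * m⁻¹ * y, contMDiff_mul_left,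
      inv_mul_cancel_right _ _, pN_mul Γ ((pN_eq_pN_iff Γ).1 h), fun u v ↦ ?_⟩) n (lif x n)
    (lif y n)
  obtain ⟨x, rfl⟩ := exists_lif_eq m u
  obtain ⟨y, rfl⟩ := exists_lif_eq m v
  have e : n * m⁻¹ * m = n := inv_mul_cancel_right _ _
  rw [D_mul_left_lif, D_mul_left_lif, e, leftInvariantMetric_lif, leftInvariantMetric_lif]

theorem D_pN_injective (Γ : Subgroup N) [DiscreteTopology Γ] (n : N) :
    Function.Injective (D E E (pN Γ) n) := by
  exact ((isSmoothQuotient_pN E Γ).isInvertible_D n).injective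

variable (E) in
theorem t2Space_leftQuotient [FiniteDimensional ℝ E] [T2Space N] (Γ : Subgroup N)
    [DiscreteTopology Γ] : T2Space (LeftQuotient Γ) := by
  have : IsTopologicalGroup N := topologicalGroup_of_lieGroup 𝓘(ℝ, E) ∞
  have : LocallyCompactSpace N := Manifold.locallyCompact_of_finiteDimensional 𝓘(ℝ, E)
  have := Γ.properlyDiscontinuousSMul_of_tendsto_cofinite
    (Γ.tendsto_coe_cofinite_of_discrete DiscreteTopology.isDiscrete)
  exact inferInstanceAs (T2Space (Quotient (MulAction.orbitRel Γ N)))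

end LeftQuotient

/-! ### The lattice `log Γ` -/

section LogLattice

variable {E : Type*} [NormedAddCommGroup E] [NormedSpace ℝ E] [FiniteDimensional ℝ E]
  [CompleteSpace E] {N : Type*} [TopologicalSpace N] [T2Space N] [ChartedSpace E N] [Group N]
  [LieGroup 𝓘(ℝ, E) ∞ N]

theorem isCentralSplitting_vProj (hN : IsTwoStep E N) {v : Submodule ℝ E}
    (hc : IsCompl (center E N) v) :
    IsCentralSplitting (br E N) (center E N) v (vProj hc) where
  alt := br_self E N
  mem_center := mem_center_iff E N
  twoStep := hN.br_mem
  sub_mem x := by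
    rw [← Submodule.projectionOnto_apply_eq_zero_iff hc.symm, map_sub, vProj,
      Submodule.projectionOnto_apply_left, sub_self]
  apply_of_mem x hx := (Submodule.projectionOnto_apply_eq_zero_iff hc.symm).2 hx
  apply_coe y := Submodule.projectionOnto_apply_left hc.symm y

variable [SimplyConnectedSpace N]

/-- The logarithms of a lattice form a lattice for the Baker–Campbell–Hausdorff group law.
Compactness of `Γ\N` is used through the cover by the images of the balls of integral radius. -/
theorem isBCHLattice_logSet (hN : IsTwoStep E N) (Γ : Subgroup N) [DiscreteTopology Γ]
    [CompactSpace (LeftQuotient Γ)] : IsBCHLattice (br E N) (logSet E Γ) where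
  zero_mem := by
    change exp E N 0 ∈ Γ
    rw [exp_zero]
    exact Γ.one_mem
  neg_mem x hx := by
    change exp E N (-x) ∈ Γ
    rw [exp_neg]
    exact Γ.inv_mem hx
  mul_mem x hx y hy := by
    change exp E N (x + y + (1 / 2 : ℝ) • br E N x y) ∈ Γ
    rw [← hN.exp_mul_exp]
    exact Γ.mul_mem hx hy
  discrete := by
    obtain ⟨U, hU, hU1⟩ := isOpen_induced_iff.1 (isOpen_discrete ({1} : Set Γ))
    have h1 : U ∈ 𝓝 (exp E N 0) := by
      rw [exp_zero]
      have : (1 : Γ) ∈ ((↑) : Γ → N) ⁻¹' U := by rw [hU1]; rfl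
      exact hU.mem_nhds this
    obtain ⟨ε, hε, h2⟩ :=
      Metric.eventually_nhds_iff.1 (hN.contMDiff_exp.continuous.continuousAt.eventually h1)
    refine ⟨ε, hε, fun x hx hxε ↦ hN.exp_injective ?_⟩
    have h3 : (⟨exp E N x, hx⟩ : Γ) ∈ ((↑) : Γ → N) ⁻¹' U := h2 (by simpa using hxε)
    rw [hU1] at h3
    rw [exp_zero]
    exact congrArg Subtype.val h3
  cocompact := by
    let U : ℕ → Set (LeftQuotient Γ) := fun k ↦ pN Γ '' (hN.log ⁻¹' Metric.ball 0 k)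
    have hU : ∀ k, IsOpen (U k) := fun k ↦ (pN_isLocalHomeomorph E Γ).isOpenMap _
      (Metric.isOpen_ball.preimage hN.contMDiff_log.continuous)
    have hcov : Set.univ ⊆ ⋃ k, U k := by
      intro q _
      obtain ⟨n, rfl⟩ := pN_surjective Γ q
      obtain ⟨k, hk⟩ := exists_nat_gt ‖hN.log n‖
      exact Set.mem_iUnion.2 ⟨k, n, by simpa using hk, rfl⟩
    have hmono : Monotone U := fun k l hkl ↦
      Set.image_mono (Set.preimage_mono (Metric.ball_subset_ball (by exact_mod_cast hkl)))
    obtain ⟨R, hR⟩ := isCompact_univ.elim_directed_cover U hU hcov hmono.directed_le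
    refine ⟨R, fun x ↦ ?_⟩
    obtain ⟨m, hm, hmx⟩ := hR (Set.mem_univ (pN Γ (exp E N x)))
    refine ⟨hN.log (exp E N x * m⁻¹), ?_, hN.log m, ?_, ?_⟩
    · change exp E N (hN.log _) ∈ Γ
      rw [hN.exp_log]
      exact (pN_eq_pN_iff Γ).1 hmx
    · exact (by simpa using hm : ‖hN.log m‖ < R).le
    · apply hN.exp_injective
      rw [← hN.exp_mul_exp, hN.exp_log, hN.exp_log, inv_mul_cancel_right]

end LogLattice

/-! ### The submersion onto the base torus -/

section Submersion

variable {E : Type*} [NormedAddCommGroup E] [NormedSpace ℝ E] [FiniteDimensional ℝ E]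
  [CompleteSpace E] {N : Type*} [TopologicalSpace N] [T2Space N] [ChartedSpace E N] [Group N]
  [LieGroup 𝓘(ℝ, E) ∞ N] [SimplyConnectedSpace N]
  {Γ : Subgroup N} {v : Submodule ℝ E}

/-- The map `Γ\N → 𝔳 / L` induced by the projection `π : 𝔫 → 𝔳` along the center. It is computed
at an arbitrary preimage in `N`, so it is meaningful when `L` contains `π (log Γ)`. -/
def baseMap (hN : IsTwoStep E N) (hc : IsCompl (center E N) v) (L : AddSubgroup v)
    (q : LeftQuotient Γ) : Torus L :=
  Torus.mk L (vProj hc (hN.log (Function.surjInv (pN_surjective Γ) q)))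

variable (hN : IsTwoStep E N) (hc : IsCompl (center E N) v) {L : AddSubgroup v}
include hN

theorem vProj_mul (x y : E) :
    vProj hc (x + y + (1 / 2 : ℝ) • br E N x y) = vProj hc x + vProj hc y :=
  (isCentralSplitting_vProj hN hc).proj_mul x y

/-- The exponential of a central vector is a central factor. It is placed on the left, where `Γ`
acts. -/
theorem exp_add_center (x : E) (z : center E N) :
    exp E N (x + z) = exp E N z * exp E N x := by
  rw [add_comm, hN.exp_mul_exp, br_swap, mem_center_iff E N z |>.1 z.2]
  simp

variable (hL : (L : Set v) = vProj hc '' logSet E Γ)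
include hL

/-- Elements of `𝔫` with the same image in `Γ\N` have projections that differ by an element of
`π (log Γ)`. -/
theorem pN_exp_eq_imp {x y : E} (h : pN Γ (exp E N x) = pN Γ (exp E N y)) :
    Torus.mk L (vProj hc x) = Torus.mk L (vProj hc y) := by
  rw [Torus.mk_eq_mk_iff]
  have h1 := (pN_eq_pN_iff Γ).1 h
  rw [← exp_neg, hN.exp_mul_exp] at h1
  have h2 : vProj hc (y + -x + (1 / 2 : ℝ) • br E N y (-x)) ∈ (L : Set v) := by
    rw [hL]
    exact ⟨_, h1, rfl⟩
  rwa [vProj_mul hN, map_neg, ← sub_eq_add_neg] at h2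

theorem baseMap_pN_exp (x : E) :
    baseMap hN hc L (pN Γ (exp E N x)) = Torus.mk L (vProj hc x) := by
  refine pN_exp_eq_imp hN hc hL ?_
  rw [hN.exp_log]
  exact Function.surjInv_eq _ _

variable [DiscreteTopology Γ] [DiscreteTopology L]

theorem contMDiff_baseMap :
    ContMDiff 𝓘(ℝ, E) 𝓘(ℝ, v) ∞ (baseMap hN hc L : LeftQuotient Γ → Torus L) := by
  refine (isSmoothQuotient_pN E Γ).contMDiff_of_comp ?_
  have h1 : (fun n : N ↦ baseMap hN hc L (pN Γ n)) =
      fun n ↦ Torus.mk L ((vProj hc).toContinuousLinearMap (hN.log n)) := by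
    ext n
    obtain ⟨x, rfl⟩ := hN.exp_surjective n
    rw [baseMap_pN_exp hN hc hL, hN.log_exp]
    rfl
  rw [h1]
  exact (Torus.isSmoothQuotient L).contMDiff.comp
    ((ContinuousLinearMap.contDiff _).contMDiff.comp hN.contMDiff_log)

/-- The differential of the base map sends the left-invariant field `x` to the constant field
`π x`. -/
theorem D_baseMap_frame (a x : E) :
    D E v (baseMap hN hc L : LeftQuotient Γ → Torus L) (pN Γ (exp E N a))
      (frame Γ x (exp E N a)) = D v v (Torus.mk L) (vProj hc a) (vProj hc x) := by
  let π' : E →L[ℝ] v := (vProj hc).toContinuousLinearMap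
  obtain ⟨A, hA, hA'⟩ := hN.exists_hasD_exp a
  have h1 := (hasD_of_contMDiff (contMDiff_baseMap hN hc hL (Γ := Γ)) _).comp
    (((isSmoothQuotient_pN E Γ).hasD _).comp hA)
  have h2 := ((Torus.isSmoothQuotient L).hasD (π' a)).comp
    (hasD_iff_hasFDerivAt.2 (π'.hasFDerivAt (x := a)))
  have h3 : (fun x ↦ baseMap hN hc L (pN Γ (exp E N x))) = fun x ↦ Torus.mk L (π' x) :=
    funext fun x ↦ baseMap_pN_exp hN hc hL x
  rw [h3] at h1
  -- the vector that `exp` maps to the value of the left-invariant field `x`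
  have h4 := DFunLike.congr_fun (h1.unique h2) (x + (1 / 2 : ℝ) • br E N a x)
  have h5 : A (x + (1 / 2 : ℝ) • br E N a x) = lif x (exp E N a) := by
    rw [hA', map_add, map_smul, hN.br_br, smul_zero, add_zero, add_sub_cancel_right]
  have h6 : π' (x + (1 / 2 : ℝ) • br E N a x) = vProj hc x := by
    have h := isCentralSplitting_vProj hN hc
    change vProj hc _ = _
    rw [map_add, map_smul, h.apply_of_mem _ (h.twoStep _ _), smul_zero, add_zero]
  simp only [ContinuousLinearMap.comp_apply, h5, h6] at h4
  exact h4

theorem isGeneralizedSubmersion_baseMap (B : LinearMap.BilinForm ℝ E) :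
    IsGeneralizedSubmersion B Γ v L (baseMap hN hc L) where
  contMDiff := contMDiff_baseMap hN hc hL
  surjective t := by
    obtain ⟨w, rfl⟩ := Torus.mk_surjective L t
    refine ⟨pN Γ (exp E N w), ?_⟩
    rw [baseMap_pN_exp hN hc hL, (isCentralSplitting_vProj hN hc).apply_coe]
  surjective_mfderiv q := by
    obtain ⟨n, rfl⟩ := pN_surjective Γ q
    obtain ⟨a, rfl⟩ := hN.exp_surjective n
    intro t
    obtain ⟨w, hw⟩ := ((Torus.isSmoothQuotient L).isInvertible_D (vProj hc a)).surjective t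
    refine ⟨frame Γ (w : E) (exp E N a), ?_⟩
    refine (D_baseMap_frame hN hc hL a w).trans ?_
    rw [(isCentralSplitting_vProj hN hc).apply_coe, hw]
  vertical n x := by
    obtain ⟨a, rfl⟩ := hN.exp_surjective n
    have h1 := D_baseMap_frame hN hc hL a x (Γ := Γ)
    change D E v (baseMap hN hc L : LeftQuotient Γ → Torus L) (pN Γ (exp E N a))
      (frame Γ x (exp E N a)) = 0 ↔ _
    rw [h1, map_eq_zero_iff _ ((Torus.isSmoothQuotient L).isInvertible_D (vProj hc a)).injective]
    exact Submodule.projectionOnto_apply_eq_zero_iff hc.symm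
  horizontal n x hx y hy := by
    obtain ⟨a, rfl⟩ := hN.exp_surjective n
    rw [quotMetric_frame]
    have h := isCentralSplitting_vProj hN hc
    have h1 := Torus.metric_mk L (B.restrict v) (vProj hc a) (vProj hc x) (vProj hc y)
    rw [← D_baseMap_frame hN hc hL a x, ← D_baseMap_frame hN hc hL a y,
      ← baseMap_pN_exp hN hc hL] at h1
    refine h1.trans ?_
    rw [h.apply_coe ⟨x, hx⟩, h.apply_coe ⟨y, hy⟩]
    rfl

end Submersion

/-! ### The fibers of the submersion -/

section Fibers

variable {E : Type*} [NormedAddCommGroup E] [NormedSpace ℝ E] [FiniteDimensional ℝ E]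
  [CompleteSpace E] {N : Type*} [TopologicalSpace N] [T2Space N] [ChartedSpace E N] [Group N]
  [LieGroup 𝓘(ℝ, E) ∞ N] [SimplyConnectedSpace N]
  {Γ : Subgroup N}

/-- The map `𝔷 / Λ → Γ\N` induced by `z ↦ exp (a + z)`. It is computed at an arbitrary preimage in
the center `𝔷`, so it is meaningful when `Λ` is contained in `log Γ`. -/
def fiberMap (Γ : Subgroup N) (Λ : AddSubgroup (center E N)) (a : E) (t : Torus Λ) :
    LeftQuotient Γ :=
  pN Γ (exp E N (a + (Function.surjInv (Torus.mk_surjective Λ) t : center E N)))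

variable (hN : IsTwoStep E N) {Λ : AddSubgroup (center E N)}
  (hΛ : ∀ z, z ∈ Λ ↔ (z : E) ∈ logSet E Γ) (a : E)
include hN hΛ

theorem pN_exp_add_eq_iff {z w : center E N} :
    pN Γ (exp E N (a + z)) = pN Γ (exp E N (a + w)) ↔ Torus.mk Λ z = Torus.mk Λ w := by
  have h : exp E N (a + w) * (exp E N (a + z))⁻¹ = exp E N (w - z : center E N) := by
    have h1 : a + (w : E) = (a + z) + ((w - z : center E N) : E) := by
      rw [Submodule.coe_sub]
      abel
    rw [h1, exp_add_center hN, mul_inv_cancel_right]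
  rw [pN_eq_pN_iff, Torus.mk_eq_mk_iff, hΛ, h]
  rfl

theorem fiberMap_mk (z : center E N) : fiberMap Γ Λ a (Torus.mk Λ z) = pN Γ (exp E N (a + z)) :=
  (pN_exp_add_eq_iff hN hΛ a).2 (Function.surjInv_eq _ _)

theorem fiberMap_injective : Function.Injective (fiberMap Γ Λ a) := fun s t h ↦ by
  obtain ⟨z, rfl⟩ := Torus.mk_surjective Λ s
  obtain ⟨w, rfl⟩ := Torus.mk_surjective Λ t
  rw [fiberMap_mk hN hΛ, fiberMap_mk hN hΛ] at h
  exact (pN_exp_add_eq_iff hN hΛ a).1 h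

theorem range_fiberMap {v : Submodule ℝ E} (hc : IsCompl (center E N) v) {L : AddSubgroup v}
    (hL : (L : Set v) = vProj hc '' logSet E Γ) :
    Set.range (fiberMap Γ Λ a) = baseMap hN hc L ⁻¹' {Torus.mk L (vProj hc a)} := by
  have hs := isCentralSplitting_vProj hN hc
  ext q
  constructor
  · rintro ⟨t, rfl⟩
    obtain ⟨z, rfl⟩ := Torus.mk_surjective Λ t
    rw [fiberMap_mk hN hΛ, Set.mem_preimage, baseMap_pN_exp hN hc hL, map_add,
      hs.apply_of_mem _ z.2, add_zero]
    rfl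
  · intro hq
    obtain ⟨n, rfl⟩ := pN_surjective Γ q
    obtain ⟨x, rfl⟩ := hN.exp_surjective n
    rw [Set.mem_preimage, baseMap_pN_exp hN hc hL, Set.mem_singleton_iff,
      Torus.mk_eq_mk_iff] at hq
    obtain ⟨g, hg, hgx⟩ : vProj hc a - vProj hc x ∈ vProj hc '' logSet E Γ := hL ▸ hq
    -- the translate of `exp x` by `exp g` has the same projection as `exp a`
    let y : E := g + x + (1 / 2 : ℝ) • br E N g x
    have hy : y - a ∈ center E N := by
      rw [← Submodule.projectionOnto_apply_eq_zero_iff hc.symm]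
      change vProj hc (y - a) = 0
      rw [map_sub, vProj_mul hN, hgx]
      abel
    refine ⟨Torus.mk Λ ⟨y - a, hy⟩, ?_⟩
    rw [fiberMap_mk hN hΛ]
    change pN Γ (exp E N (a + (y - a))) = _
    rw [add_sub_cancel, ← hN.exp_mul_exp]
    exact pN_mul Γ hg _

variable [DiscreteTopology Γ] [DiscreteTopology Λ]

theorem contMDiff_fiberMap : ContMDiff 𝓘(ℝ, center E N) 𝓘(ℝ, E) ∞ (fiberMap Γ Λ a) := by
  refine (Torus.isSmoothQuotient Λ).contMDiff_of_comp ?_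
  have h1 : (fun z ↦ fiberMap Γ Λ a (Torus.mk Λ z)) =
      fun z ↦ pN Γ (exp E N (a + (center E N).subtypeL z)) :=
    funext fun z ↦ fiberMap_mk hN hΛ a z
  rw [h1]
  exact (isSmoothQuotient_pN E Γ).contMDiff.comp (hN.contMDiff_exp.comp
    (contDiff_const.add (ContinuousLinearMap.contDiff _)).contMDiff)

/-- The differential of the fiber map sends the constant field `u` to the left-invariant field `u`,
as `exp` maps the central direction `u` at any point to the left-invariant field `u`. -/
theorem D_fiberMap_mk (z u : center E N) :
    D (center E N) E (fiberMap Γ Λ a) (Torus.mk Λ z)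
      (D (center E N) (center E N) (Torus.mk Λ) z u) = frame Γ (u : E) (exp E N (a + z)) := by
  let ι : center E N →L[ℝ] E := (center E N).subtypeL
  obtain ⟨A, hA, hA'⟩ := hN.exists_hasD_exp (a + z)
  have h1 := (hasD_of_contMDiff (contMDiff_fiberMap hN hΛ a) _).comp
    ((Torus.isSmoothQuotient Λ).hasD z)
  have h2 := (((isSmoothQuotient_pN E Γ).hasD _).comp hA).comp_of_eq (f := fun z ↦ a + ι z)
    (x := z) (hasD_iff_hasFDerivAt.2 ((ι.hasFDerivAt (x := z)).const_add a)) rfl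
  have h3 : (fun z ↦ fiberMap Γ Λ a (Torus.mk Λ z)) = fun z ↦ pN Γ (exp E N (a + ι z)) :=
    funext fun z ↦ fiberMap_mk hN hΛ a z
  rw [h3] at h1
  have h4 := DFunLike.congr_fun (h1.unique h2) u
  have h5 : A u = lif (u : E) (exp E N (a + z)) := by
    rw [hA', (mem_center_iff E N u).1 u.2, smul_zero, sub_zero]
  refine h4.trans ?_
  change D E E (pN Γ) _ (A u) = _
  rw [h5]
  rfl

theorem isIsometricEmbedding_fiberMap [CompactSpace (Torus Λ)] (B : LinearMap.BilinForm ℝ E) :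
    IsIsometricEmbedding (Torus.metric Λ (B.restrict (center E N))) (quotMetric E Γ B)
      (fiberMap Γ Λ a) where
  contMDiff := contMDiff_fiberMap hN hΛ a
  isEmbedding := by
    have := t2Space_leftQuotient E Γ
    exact ((contMDiff_fiberMap hN hΛ a).continuous.isClosedEmbedding
      (fiberMap_injective hN hΛ a)).isEmbedding
  injective_mfderiv t := by
    obtain ⟨z, rfl⟩ := Torus.mk_surjective Λ t
    change Function.Injective (D (center E N) E (fiberMap Γ Λ a) (Torus.mk Λ z))
    intro s t hst
    obtain ⟨u, rfl⟩ := ((Torus.isSmoothQuotient Λ).isInvertible_D z).surjective s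
    obtain ⟨w, rfl⟩ := ((Torus.isSmoothQuotient Λ).isInvertible_D z).surjective t
    rw [D_fiberMap_mk hN hΛ, D_fiberMap_mk hN hΛ] at hst
    rw [Subtype.ext (lif_injective _ (D_pN_injective Γ _ hst))]
  isometric t s s' := by
    obtain ⟨z, rfl⟩ := Torus.mk_surjective Λ t
    obtain ⟨u, rfl⟩ := ((Torus.isSmoothQuotient Λ).isInvertible_D z).surjective s
    obtain ⟨w, rfl⟩ := ((Torus.isSmoothQuotient Λ).isInvertible_D z).surjective s'
    have h1 := quotMetric_frame Γ B (exp E N (a + z)) u w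
    rw [← D_fiberMap_mk hN hΛ, ← D_fiberMap_mk hN hΛ, ← fiberMap_mk hN hΛ] at h1
    exact h1.trans (Torus.metric_mk Λ (B.restrict (center E N)) z u w).symm

end Fibers

end Nilmanifold

end

theorem mainTheorem6 {E : Type*} [NormedAddCommGroup E] [NormedSpace ℝ E] [FiniteDimensional ℝ E]
    [CompleteSpace E] {N : Type*} [TopologicalSpace N] [T2Space N] [ChartedSpace E N] [Group N]
    [LieGroup 𝓘(ℝ, E) ∞ N] [SimplyConnectedSpace N] (hN : Nilmanifold.IsTwoStep E N)
    (Γ : Subgroup N) [DiscreteTopology Γ] [CompactSpace (Nilmanifold.LeftQuotient Γ)]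
    (B : LinearMap.BilinForm ℝ E) (hs : B.IsSymm) (hB : B.Nondegenerate)
    (V : Submodule ℝ E) (hV : Nilmanifold.IsWittComplement B (Nilmanifold.center E N) V) :
    ∃ (Λ : AddSubgroup (Nilmanifold.center E N))
      (L : AddSubgroup (Nilmanifold.vSpace B (Nilmanifold.center E N) V)),
      (∀ z, z ∈ Λ ↔ (z : E) ∈ Nilmanifold.logSet E Γ) ∧
      ((L : Set (Nilmanifold.vSpace B (Nilmanifold.center E N) V)) =
        Nilmanifold.vProj (Nilmanifold.isCompl_vSpace hs hB hV) '' Nilmanifold.logSet E Γ) ∧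
      Submodule.span ℝ (Λ : Set (Nilmanifold.center E N)) = ⊤ ∧
      Submodule.span ℝ (L : Set (Nilmanifold.vSpace B (Nilmanifold.center E N) V)) = ⊤ ∧
      ∃ (_ : DiscreteTopology Λ) (_ : DiscreteTopology L)
        (p : Nilmanifold.LeftQuotient Γ → Nilmanifold.Torus L),
        (∀ x : E, p (Nilmanifold.pN Γ (Nilmanifold.exp E N x)) =
          Nilmanifold.Torus.mk L (Nilmanifold.vProj (Nilmanifold.isCompl_vSpace hs hB hV) x)) ∧
        Nilmanifold.IsGeneralizedSubmersion B Γ _ L p ∧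
        ∀ b : Nilmanifold.Torus L, ∃ f : Nilmanifold.Torus Λ → Nilmanifold.LeftQuotient Γ,
          Nilmanifold.IsIsometricEmbedding
            (Nilmanifold.Torus.metric Λ (B.restrict (Nilmanifold.center E N)))
            (Nilmanifold.quotMetric E Γ B) f ∧
          Set.range f = p ⁻¹' {b} := by
  have hc := Nilmanifold.isCompl_vSpace hs hB hV
  have h := Nilmanifold.isCentralSplitting_vProj hN hc
  have hG := Nilmanifold.isBCHLattice_logSet hN Γ
  have hΛ : ∀ z, z ∈ hG.central h ↔ (z : E) ∈ Nilmanifold.logSet E Γ := fun _ ↦ Iff.rfl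
  have hL : (hG.proj h : Set (Nilmanifold.vSpace B (Nilmanifold.center E N) V)) =
    Nilmanifold.vProj hc '' Nilmanifold.logSet E Γ := rfl
  have hdΛ := hG.discreteTopology_central h
  have hdL := hG.discreteTopology_proj h
  obtain ⟨R, hR⟩ := hG.exists_central_norm_sub_le h
  have hT := Nilmanifold.Torus.compactSpace (hG.central h) hR
  refine ⟨hG.central h, hG.proj h, hΛ, hL, hG.span_central h, hG.span_proj h, hdΛ, hdL,
    Nilmanifold.baseMap hN hc _, Nilmanifold.baseMap_pN_exp hN hc hL,
    Nilmanifold.isGeneralizedSubmersion_baseMap hN hc hL B, fun b ↦ ?_⟩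
  obtain ⟨w, rfl⟩ := Nilmanifold.Torus.mk_surjective _ b
  refine ⟨Nilmanifold.fiberMap Γ _ (w : E),
    Nilmanifold.isIsometricEmbedding_fiberMap hN hΛ (w : E) B, ?_⟩
  rw [Nilmanifold.range_fiberMap hN hΛ w hc hL, h.apply_coe]
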